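/- Let $0<\beta<\alpha<1$ and let $T=T_{\alpha,\beta}:[0,1)\to[0,1)$ be the interval translation map $T(x)=x+\alpha$ for $x\in[0,1-\alpha)$, $T(x)=x+\beta$ for $x\in[1-\alpha,1-\beta)$, $T(x)=x+\beta-1$ for $x\in[1-\beta,1)$. Put $\Omega_0=[0,1)$ and $\Omega_{n+1}=T(\Omega_n)$, and suppose that $T$ is of infinite type, i.e. $\Omega_{n+1}\ne\Omega_n$ for every $n\ge 0$. Let $G(\alpha,\beta)=\left(\frac{\beta}{\alpha},\ \frac{\beta-1}{\alpha}+\left\lfloor\frac1\alpha\right\rfloor\right)$, write $(\alpha_n,\beta_n)=G^n(\alpha,\beta)$, and let $(k_n)_{n\ge0}$ be the coding sequence $k_n=\lfloor 1/\alpha_n\rfloor$. For $n\ge 1$ let $L_n=\min\{r\ge1 : k_{n+r}\neq 1\}$. If at least one of the four conditions $$\sum_{i\ge1}\frac{k_{2i}-1}{k_{2i}}\sqrt{\frac{1}{k_{2i-1}L_{2i}}}=\infty,\qquad \prod_{i\ge1}\frac{k_{2i}}{k_{2i-1}+\frac1{L_{2i}}}=0,$$ $$\sum_{i\ge1}\frac{k_{2i-1}-1}{k_{2i-1}}\sqrt{\frac{1}{k_{2i-2}L_{2i-1}}}=\infty,\qquad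 \prod_{i\ge1}\frac{k_{2i-1}}{k_{2i-2}+\frac1{L_{2i-1}}}=0$$ holds (an infinite product being the limit of its partial products), then $T$ is uniquely ergodic: there is exactly one $T$-invariant Borel probability measure on $[0,1)$. -/

import Mathlib

open Filter Topology MeasureTheory

noncomputable section

namespace ITM

/-- The interval translation map `T_{α,β}` on `[0,1)`, with branches `[0,1-α)`, `[1-α,1-β)` and
`[1-β,1)`.  It is written as a function on `ℝ`, and used only on `[0,1)`. -/
def T (α β : ℝ) (x : ℝ) : ℝ :=
  if x < 1 - α then x + α else if x < 1 - β then x + β else x + β - 1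

/-- For `0 ≤ β ≤ α ≤ 1` the interval `[0,1)` is mapped into itself. -/
theorem mapsTo_T {α β : ℝ} (h0 : 0 ≤ β) (h1 : β ≤ α) (h2 : α ≤ 1) :
    Set.MapsTo (T α β) (Set.Ico 0 1) (Set.Ico 0 1) := by
  rintro x ⟨hx0, hx1⟩
  unfold T
  split_ifs <;> constructor <;> linarith

/-- `Ω_0 = [0,1)` and `Ω_{n+1} = T(Ω_n)`. -/
def Omega (α β : ℝ) : ℕ → Set ℝ
  | 0 => Set.Ico 0 1
  | n + 1 => T α β '' Omega α β n

/-- `T_{α,β}` is of finite type if the nested sequence `Ω_n` stabilizes. -/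
def IsFiniteType (α β : ℝ) : Prop := ∃ n, Omega α β n = Omega α β (n + 1)

/-- `T_{α,β}` is of infinite type if `Ω_{n+1} ≠ Ω_n` for every `n`. -/
def IsInfiniteType (α β : ℝ) : Prop := ¬ IsFiniteType α β

/-- The Gauss map `G(α,β) = (β/α, (β-1)/α + ⌊1/α⌋)`, which gives the parameters of the rescaled
first return map of `T_{α,β}` to `[1-α,1)`. -/
def gaussMap (p : ℝ × ℝ) : ℝ × ℝ :=
  (p.2 / p.1, (p.2 - 1) / p.1 + (⌊1 / p.1⌋ : ℝ))

/-- The coding sequence: `k_n = j` iff the first coordinate `α_n` of `G^n(α,β)` satisfies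
`1/(j+1) < α_n ≤ 1/j`, that is, `k_n = ⌊1/α_n⌋`. -/
def code (α β : ℝ) (n : ℕ) : ℕ := ⌊1 / (gaussMap^[n] (α, β)).1⌋₊

/-- `L_n = min {r ≥ 1 : k_{n+r} ≠ 1}`. -/
def gap (k : ℕ → ℕ) (n : ℕ) : ℕ := sInf {r : ℕ | 1 ≤ r ∧ k (n + r) ≠ 1}

/-- The expression `(k_n - 1)/k_n · √(1/(k_{n-1} L_n))`, for `n ≥ 1`. -/
def sumTerm (k : ℕ → ℕ) (n : ℕ) : ℝ :=
  ((k n : ℝ) - 1) / (k n : ℝ) * Real.sqrt (1 / ((k (n - 1) : ℝ) * (gap k n : ℝ)))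

/-- The expression `k_n/(k_{n-1} + 1/L_n)`, for `n ≥ 1`. -/
def prodTerm (k : ℕ → ℕ) (n : ℕ) : ℝ :=
  (k n : ℝ) / ((k (n - 1) : ℝ) + 1 / (gap k n : ℝ))

/-- `T_{α,β}` is uniquely ergodic: there is exactly one `T_{α,β}`-invariant Borel probability
measure on `[0,1)` (viewed as a measure on `ℝ` carried by `[0,1)`). -/
def IsUniquelyErgodic (α β : ℝ) : Prop :=
  ∃! μ : Measure ℝ, IsProbabilityMeasure μ ∧ μ (Set.Ico (0 : ℝ) 1)ᶜ = 0 ∧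
    MeasurePreserving (T α β) μ μ

end ITM

end

/-!
Write the branches of `T` as `1 = [0,1-α)`, `2 = [1-α,1-β)`, `3 = [1-β,1)`.  The first return map of
`T` to `[1-α,1)`, rescaled to `[0,1)`, is `T` for the parameters `gaussMap (α,β)`; for a map of
infinite type this can be repeated for ever (`Admissible.gaussMap`).  An invariant measure `μ` induces
an invariant measure at each level, and the masses of the three branches at consecutive levels satisfy
`a = k b' + (k-1) c'`, `b = a'`, `c = b' + c'` (`IsInvariant.mass_rel`).  Everything is therefore
determined by the masses `c n` of the third branches, which satisfy, with `d n = c n - c (n+1) ≥ 0`,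
the recursion `d n = d (n+2) + (k (n+2) - 1) c (n+2)` (`MassSequence`).

*The mass sequences form a ray.*  Given two of them, let `c` be their sum, and let `f`, `g` be the
proportions that the first one contributes to `d` and to `c`.  Then `g n` is a mean of `f n` and
`g (n+1)`, and `f n` is a mean of `f (n+2)` and `g (n+2)`.  It follows that (up to exchanging the two
sequences) the even terms of `f` increase, the odd ones decrease, and `g` stays in between
(`RatioSystem.evenHigh_or`).  If they are not all equal, the two parity classes have different
limits, so the masses of the two classes hardly mix.  A digit `k n = 1` mixes them, so only finitely
many digits are `1` (`Oriented.eventually_succ_ne_one_of_even`), and once all digits are at least `2`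
the increments of `f` dominate the ratios `c (n+1) / c n`, which are then summable
(`Oriented.summable_ratio`).  Summability of these ratios `r n` contradicts each of the four
conditions: `1 / k (n+2) ≤ 2 r n r (n+1)` makes `∑ 1 / √(k n)` finite, and the products nearly
telescope along `r`, hence stay away from zero.

*Uniqueness.*  Two invariant probability measures thus give the same masses to the three branches at
each level.  Kac's formula expresses the integral of a continuous function through the induced
measures, the integrand having small relative oscillation on each branch once the renormalization
interval is short; so the integrals agree (`IsInvariant.eq_of_mass_eq`).

*Existence.*  The counting measure on a periodic orbit would give a strictly decreasing sequence of
natural numbers `c n`, so there are no periodic points, and an orbit visits short intervals with small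
frequency.  Frequencies along an ultrafilter therefore have a continuous distribution function, and
the measure it defines is invariant although `T` is discontinuous.
-/

/-! ### Ratios of two mass sequences -/

namespace ITM

/-- Two solutions of the mass recursion, recorded by their sum `c`, its
differences `d`, and the proportions `f n`, `g n` in which one of them contributes to `d n`, `c n`. -/
structure RatioSystem (k : ℕ → ℕ) (c d f g : ℕ → ℝ) : Prop where
  k_pos : ∀ n, 1 ≤ k n
  freq : ∀ n, ∃ m, 2 ≤ k (n + 2 * m)
  c_pos : ∀ n, 0 < c n
  d_pos : ∀ n, 0 < d n
  c_eq : ∀ n, c n = d n + c (n + 1)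
  d_eq : ∀ n, d n = d (n + 2) + ((k (n + 2) : ℝ) - 1) * c (n + 2)
  cg_eq : ∀ n, c n * g n = d n * f n + c (n + 1) * g (n + 1)
  df_eq : ∀ n, d n * f n = d (n + 2) * f (n + 2) + ((k (n + 2) : ℝ) - 1) * (c (n + 2) * g (n + 2))
  f_nonneg : ∀ n, 0 ≤ f n
  f_le_one : ∀ n, f n ≤ 1
  g_nonneg : ∀ n, 0 ≤ g n
  g_le_one : ∀ n, g n ≤ 1

/-- At level `n` the value `g (n+2)` lies between `f n` and `f (n+1)`, the one with the even index being
the upper bound. -/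
def EvenHigh (f g : ℕ → ℝ) (n : ℕ) : Prop :=
  (Even n → f (n + 1) ≤ g (n + 2) ∧ g (n + 2) ≤ f n) ∧
  (Odd n → f n ≤ g (n + 2) ∧ g (n + 2) ≤ f (n + 1))

namespace RatioSystem

variable {k : ℕ → ℕ} {c d f g : ℕ → ℝ}

theorem shift (h : RatioSystem k c d f g) (j : ℕ) :
    RatioSystem (fun n => k (n + j)) (fun n => c (n + j)) (fun n => d (n + j))
      (fun n => f (n + j)) (fun n => g (n + j)) where
  k_pos n := h.k_pos _
  freq n := by
    obtain ⟨m, hm⟩ := h.freq (n + j)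
    exact ⟨m, by rwa [show n + 2 * m + j = n + j + 2 * m by ring]⟩
  c_pos n := h.c_pos _
  d_pos n := h.d_pos _
  c_eq n := by rw [h.c_eq (n + j), show n + j + 1 = n + 1 + j by ring]
  d_eq n := by rw [h.d_eq (n + j), show n + j + 2 = n + 2 + j by ring]
  cg_eq n := by rw [h.cg_eq (n + j), show n + j + 1 = n + 1 + j by ring]
  df_eq n := by rw [h.df_eq (n + j), show n + j + 2 = n + 2 + j by ring]
  f_nonneg n := h.f_nonneg _
  f_le_one n := h.f_le_one _
  g_nonneg n := h.g_nonneg _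
  g_le_one n := h.g_le_one _

theorem compl (h : RatioSystem k c d f g) :
    RatioSystem k c d (fun n => 1 - f n) (fun n => 1 - g n) where
  k_pos := h.k_pos
  freq := h.freq
  c_pos := h.c_pos
  d_pos := h.d_pos
  c_eq := h.c_eq
  d_eq := h.d_eq
  cg_eq n := by linear_combination h.c_eq n - h.cg_eq n
  df_eq n := by linear_combination h.d_eq n - h.df_eq n
  f_nonneg n := sub_nonneg.2 (h.f_le_one n)
  f_le_one n := sub_le_self _ (h.f_nonneg n)
  g_nonneg n := sub_nonneg.2 (h.g_le_one n)
  g_le_one n := sub_le_self _ (h.g_nonneg n)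

theorem k_sub_nonneg (h : RatioSystem k c d f g) (n : ℕ) : 0 ≤ (k n : ℝ) - 1 := by
  have : (1 : ℝ) ≤ k n := by exact_mod_cast h.k_pos n
  linarith

theorem one_le_k_sub {n : ℕ} (hk : 2 ≤ k n) : 1 ≤ (k n : ℝ) - 1 := by
  have : (2 : ℝ) ≤ k n := by exact_mod_cast hk
  linarith

theorem c_succ_le (h : RatioSystem k c d f g) (n : ℕ) : c (n + 1) ≤ c n := by
  linarith [h.c_eq n, h.d_pos n]

theorem d_add_two_le (h : RatioSystem k c d f g) (n : ℕ) : d (n + 2) ≤ d n := by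
  have := mul_nonneg (h.k_sub_nonneg (n + 2)) (h.c_pos (n + 2)).le
  linarith [h.d_eq n]

/-- If `g (n+1)` and `f n` lie in an interval, so does their weighted mean `g n`. -/
theorem g_le_of (h : RatioSystem k c d f g) {n : ℕ} {t : ℝ} (h1 : f n ≤ t) (h2 : g (n + 1) ≤ t) :
    g n ≤ t := by
  have h3 := mul_le_mul_of_nonneg_left h1 (h.d_pos n).le
  have h4 := mul_le_mul_of_nonneg_left h2 (h.c_pos (n + 1)).le
  have h5 := h.cg_eq n
  have h6 := h.c_eq n
  refine le_of_mul_le_mul_left ?_ (h.c_pos n)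
  calc c n * g n ≤ d n * t + c (n + 1) * t := by linarith
    _ = c n * t := by rw [h6]; ring

theorem le_g_of (h : RatioSystem k c d f g) {n : ℕ} {t : ℝ} (h1 : t ≤ f n) (h2 : t ≤ g (n + 1)) :
    t ≤ g n := by
  have := h.compl.g_le_of (n := n) (t := 1 - t) (by linarith) (by linarith)
  linarith

theorem f_le_of (h : RatioSystem k c d f g) {n : ℕ} {t : ℝ} (h1 : f (n + 2) ≤ t)
    (h2 : g (n + 2) ≤ t) : f n ≤ t := by
  have h3 := mul_le_mul_of_nonneg_left h1 (h.d_pos (n + 2)).le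
  have h4 := mul_le_mul_of_nonneg_left h2
    (mul_nonneg (h.k_sub_nonneg (n + 2)) (h.c_pos (n + 2)).le)
  have h5 := h.df_eq n
  have h6 := h.d_eq n
  refine le_of_mul_le_mul_left ?_ (h.d_pos n)
  calc d n * f n ≤ d (n + 2) * t + ((k (n + 2) : ℝ) - 1) * c (n + 2) * t := by linarith
    _ = d n * t := by rw [h6]; ring

theorem le_f_of (h : RatioSystem k c d f g) {n : ℕ} {t : ℝ} (h1 : t ≤ f (n + 2))
    (h2 : t ≤ g (n + 2)) : t ≤ f n := by
  have := h.compl.f_le_of (n := n) (t := 1 - t) (by linarith) (by linarith)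
  linarith

theorem tendsto_d (h : RatioSystem k c d f g) : Tendsto d atTop (𝓝 0) := by
  have hanti : Antitone c := antitone_nat_of_succ_le h.c_succ_le
  have hb : BddBelow (Set.range c) := ⟨0, by rintro _ ⟨n, rfl⟩; exact (h.c_pos n).le⟩
  have h1 := tendsto_atTop_ciInf hanti hb
  have h2 := h1.sub (h1.comp (tendsto_add_atTop_nat 1))
  rw [sub_self] at h2
  refine h2.congr fun n => ?_
  simp only [Function.comp]
  linarith [h.c_eq n]

/-- `g` cannot stay strictly above the two current values of `f` forever. -/
theorem not_forall_lt (h : RatioSystem k c d f g)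
    (hmax : ∀ n, f n < g (n + 2) ∧ f (n + 1) < g (n + 2)) : False := by
  have hg : ∀ n, g (n + 2) ≤ g (n + 3) := fun n =>
    h.g_le_of (hmax (n + 1)).2.le le_rfl
  have hH : ∀ n, d (n + 2) * (f (n + 2) - g (n + 4)) ≤ d n * (f n - g (n + 2)) := by
    intro n
    have h1 : g (n + 2) ≤ g (n + 4) := (hg n).trans (hg (n + 1))
    have h2 : d n * (f n - g (n + 2)) = d (n + 2) * (f (n + 2) - g (n + 2)) := by
      linear_combination h.df_eq n - g (n + 2) * h.d_eq n
    rw [h2]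
    exact mul_le_mul_of_nonneg_left (by linarith) (h.d_pos _).le
  have hanti : Antitone (fun i : ℕ => d (2 * i) * (f (2 * i) - g (2 * i + 2))) :=
    antitone_nat_of_succ_le fun i => hH (2 * i)
  have hlim : Tendsto (fun i : ℕ => d (2 * i) * (f (2 * i) - g (2 * i + 2))) atTop (𝓝 0) := by
    have h2 : Tendsto (fun i : ℕ => 2 * i) atTop atTop :=
      tendsto_id.const_mul_atTop' (by norm_num)
    have h3 := h.tendsto_d.comp h2
    refine squeeze_zero_norm (fun i => ?_) h3
    simp only [Function.comp, norm_mul, Real.norm_eq_abs, abs_of_pos (h.d_pos _)]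
    refine mul_le_of_le_one_right (h.d_pos _).le (abs_le.2 ⟨?_, ?_⟩)
    · linarith [h.f_nonneg (2 * i), h.g_le_one (2 * i + 2)]
    · linarith [h.f_le_one (2 * i), h.g_nonneg (2 * i + 2)]
  have h0 : 0 ≤ d (2 * 0) * (f (2 * 0) - g (2 * 0 + 2)) := hanti.le_of_tendsto hlim 0
  have h1 : d 0 * (f 0 - g 2) < 0 := mul_neg_of_pos_of_neg (h.d_pos 0) (by linarith [(hmax 0).1])
  simp only [mul_zero, zero_add] at h0
  linarith

/-- The order propagates to smaller indices, since `g (n+2)` and `f n` are means of later values. -/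
theorem evenHigh_of_succ (h : RatioSystem k c d f g) {n : ℕ} (hn : EvenHigh f g (n + 1)) :
    EvenHigh f g n := by
  constructor
  · intro he
    obtain ⟨h1, h2⟩ := hn.2 he.add_one
    exact ⟨h.le_g_of (h1.trans h2) h1, h.le_f_of (h.g_le_of le_rfl h2) le_rfl⟩
  · intro ho
    obtain ⟨h1, h2⟩ := hn.1 ho.add_one
    exact ⟨h.f_le_of (h.le_g_of le_rfl h1) le_rfl, h.g_le_of (h1.trans h2) h2⟩

theorem evenHigh_of_frequently (h : RatioSystem k c d f g) (hf : ∃ᶠ n in atTop, EvenHigh f g n)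
    (n : ℕ) : EvenHigh f g n := by
  obtain ⟨N, hN, hP⟩ := frequently_atTop.1 hf n
  clear hf
  induction N, hN using Nat.le_induction with
  | base => exact hP
  | succ m hm ih => exact ih (h.evenHigh_of_succ hP)

theorem lt_or_lt_of_not_evenHigh {n : ℕ} (h1 : ¬ EvenHigh f g n)
    (h2 : ¬ EvenHigh (fun n => 1 - f n) (fun n => 1 - g n) n) :
    (f n < g (n + 2) ∧ f (n + 1) < g (n + 2)) ∨ (g (n + 2) < f n ∧ g (n + 2) < f (n + 1)) := by
  unfold EvenHigh at h1 h2
  rcases Nat.even_or_odd n with hn | hn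
  · have hn' : ¬ Odd n := Nat.not_odd_iff_even.2 hn
    simp only [hn, hn', forall_true_left, false_implies, and_true, not_and, not_le,
      sub_le_sub_iff_left] at h1 h2
    rcases lt_trichotomy (f n) (g (n + 2)) with h | h | h
    · refine Or.inl ⟨h, ?_⟩
      by_contra! hc
      linarith [h2 hc]
    · rcases le_total (f (n + 1)) (g (n + 2)) with h3 | h3
      · linarith [h1 h3]
      · linarith [h2 h3]
    · refine Or.inr ⟨h, ?_⟩
      by_contra! hc
      linarith [h1 hc]
  · have hn' : ¬ Even n := Nat.not_even_iff_odd.2 hn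
    simp only [hn, hn', forall_true_left, false_implies, true_and, not_and, not_le,
      sub_le_sub_iff_left] at h1 h2
    rcases lt_trichotomy (f n) (g (n + 2)) with h | h | h
    · refine Or.inl ⟨h, ?_⟩
      by_contra! hc
      linarith [h1 h.le]
    · rcases le_total (f (n + 1)) (g (n + 2)) with h3 | h3
      · linarith [h2 h.ge]
      · linarith [h1 h.le]
    · refine Or.inr ⟨h, ?_⟩
      by_contra! hc
      linarith [h2 h.le]

/-- If `g` failed to lie between the `f`'s at all large indices, it would lie on one side of them for
ever. -/
theorem evenHigh_or (h : RatioSystem k c d f g) :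
    (∀ n, EvenHigh f g n) ∨ ∀ n, EvenHigh (fun n => 1 - f n) (fun n => 1 - g n) n := by
  by_cases hfreq : ∃ᶠ n in atTop,
      (EvenHigh f g n ∨ EvenHigh (fun n => 1 - f n) (fun n => 1 - g n) n)
  · rcases frequently_or_distrib.1 hfreq with h1 | h1
    · exact Or.inl (h.evenHigh_of_frequently h1)
    · exact Or.inr (h.compl.evenHigh_of_frequently h1)
  · exfalso
    rw [not_frequently, eventually_atTop] at hfreq
    obtain ⟨N, hN⟩ := hfreq
    have hst : ∀ n, N ≤ n → (f n < g (n + 2) ∧ f (n + 1) < g (n + 2)) ∨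
        (g (n + 2) < f n ∧ g (n + 2) < f (n + 1)) := fun n hn =>
      lt_or_lt_of_not_evenHigh (fun hc => hN n hn (Or.inl hc)) (fun hc => hN n hn (Or.inr hc))
    -- the alternative chosen at `N` propagates to all later indices
    rcases hst N le_rfl with h0 | h0
    · refine (h.shift N).not_forall_lt fun n => ?_
      simp only [show n + 2 + N = N + n + 2 by ring, show n + 1 + N = N + n + 1 by ring,
        add_comm n N]
      induction n with
      | zero => simpa using h0
      | succ m ih =>
        refine (hst (N + (m + 1)) (by omega)).resolve_right fun hc => ?_
        have : g (N + m + 2) ≤ f (N + m) :=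
          h.le_f_of (h.g_le_of le_rfl (hc.2.le)) le_rfl
        linarith [ih.1]
    · refine (h.compl.shift N).not_forall_lt fun n => ?_
      simp only [show n + 2 + N = N + n + 2 by ring, show n + 1 + N = N + n + 1 by ring,
        add_comm n N, sub_lt_sub_iff_left]
      induction n with
      | zero => simpa using h0
      | succ m ih =>
        refine (hst (N + (m + 1)) (by omega)).resolve_left fun hc => ?_
        have : f (N + m) ≤ g (N + m + 2) :=
          h.f_le_of (h.le_g_of le_rfl (hc.2.le)) le_rfl
        linarith [ih.1]

/-- The mean `f n` of `f (n+2)` and `g (n+2)` cannot exceed the first and dominate the second. -/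
theorem le_f_add_two (h : RatioSystem k c d f g) {n : ℕ} (h1 : g (n + 2) ≤ f n) :
    f n ≤ f (n + 2) := by
  by_contra! hc
  have h2 := h.df_eq n
  have h3 := h.d_eq n
  have h4 := mul_nonneg (h.k_sub_nonneg (n + 2)) (h.c_pos (n + 2)).le
  have h5 : d (n + 2) * (f n - f (n + 2)) +
      ((k (n + 2) : ℝ) - 1) * c (n + 2) * (f n - g (n + 2)) = 0 := by
    linear_combination h2 - f n * h3
  linarith [mul_pos (h.d_pos (n + 2)) (sub_pos.2 hc), mul_nonneg h4 (sub_nonneg.2 h1)]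

theorem f_add_two_le (h : RatioSystem k c d f g) {n : ℕ} (h1 : f n ≤ g (n + 2)) :
    f (n + 2) ≤ f n := by
  have := h.compl.le_f_add_two (n := n) (by linarith)
  linarith

end RatioSystem

theorem EvenHigh.shift {f g : ℕ → ℝ} {n j : ℕ} (h1 : EvenHigh f g (n + 2 * j)) :
    EvenHigh (fun n => f (n + 2 * j)) (fun n => g (n + 2 * j)) n := by
  simp only [EvenHigh, show n + 2 * j + 1 = n + 1 + 2 * j by ring,
    show n + 2 * j + 2 = n + 2 + 2 * j by ring] at h1 ⊢
  exact ⟨fun hn => h1.1 (hn.add (even_two_mul j)), fun hn => h1.2 (hn.add_even (even_two_mul j))⟩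

/-- A ratio system whose even ratios lie above the odd ones, strictly so at the start. -/
structure Oriented (k : ℕ → ℕ) (c d f g : ℕ → ℝ) : Prop extends RatioSystem k c d f g where
  evenHigh : ∀ n, EvenHigh f g n
  lt : f 1 < f 0

namespace Oriented

variable {k : ℕ → ℕ} {c d f g : ℕ → ℝ}

theorem even_le (h : Oriented k c d f g) {n : ℕ} (hn : Even n) : f n ≤ f (n + 2) :=
  h.le_f_add_two ((h.evenHigh n).1 hn).2

/-- Shifting by one exchanges the parities, and complementation restores the orientation. -/
theorem shift_one_compl (h : Oriented k c d f g) :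
    Oriented (fun n => k (n + 1)) (fun n => c (n + 1)) (fun n => d (n + 1))
      (fun n => 1 - f (n + 1)) (fun n => 1 - g (n + 1)) where
  toRatioSystem := h.compl.shift 1
  evenHigh n := by
    constructor
    · intro hn
      have := (h.evenHigh (n + 1)).2 hn.add_one
      constructor <;>
        simp only [show n + 1 + 1 = n + 2 by ring, show n + 2 + 1 = n + 3 by ring] at * <;>
        linarith [this.1, this.2]
    · intro hn
      have := (h.evenHigh (n + 1)).1 hn.add_one
      constructor <;>
        simp only [show n + 1 + 1 = n + 2 by ring, show n + 2 + 1 = n + 3 by ring] at * <;>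
        linarith [this.1, this.2]
  lt := by
    have := h.even_le (n := 0) (by simp)
    have := h.lt
    simp only [zero_add] at *
    norm_num
    linarith

theorem odd_le (h : Oriented k c d f g) {n : ℕ} (hn : Odd n) : f (n + 2) ≤ f n :=
  h.f_add_two_le ((h.evenHigh n).2 hn).1

theorem even_mono (h : Oriented k c d f g) {n : ℕ} (hn : Even n) (j : ℕ) : f n ≤ f (n + 2 * j) := by
  induction j with
  | zero => simp
  | succ j ih => exact ih.trans (h.even_le (hn.add (even_two_mul j)))

theorem odd_anti (h : Oriented k c d f g) {n : ℕ} (hn : Odd n) (j : ℕ) : f (n + 2 * j) ≤ f n := by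
  induction j with
  | zero => simp
  | succ j ih => exact (h.odd_le (hn.add_even (even_two_mul j))).trans ih

theorem zero_le_even (h : Oriented k c d f g) {n : ℕ} (hn : Even n) : f 0 ≤ f n := by
  obtain ⟨m, rfl⟩ := even_iff_two_dvd.1 hn
  simpa using h.even_mono (n := 0) (by simp) m

theorem odd_le_one (h : Oriented k c d f g) {n : ℕ} (hn : Odd n) : f n ≤ f 1 := by
  obtain ⟨m, rfl⟩ := hn
  simpa [add_comm] using h.odd_anti (n := 1) (by simp) m

theorem exists_limit_even (h : Oriented k c d f g) :
    ∃ E : ℝ, E ≤ 1 ∧ (∀ n, Even n → f n ≤ E) ∧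
      ∀ ε, 0 < ε → ∃ N, ∀ n, N ≤ n → Even n → E - f n ≤ ε := by
  have hmono : Monotone fun i : ℕ => f (2 * i) :=
    monotone_nat_of_le_succ fun i => h.even_le (even_two_mul i)
  have hb : BddAbove (Set.range fun i : ℕ => f (2 * i)) :=
    ⟨1, by rintro _ ⟨n, rfl⟩; exact h.f_le_one _⟩
  refine ⟨⨆ i : ℕ, f (2 * i), ciSup_le fun i => h.f_le_one _, ?_, ?_⟩
  · intro n hn
    obtain ⟨m, rfl⟩ := even_iff_two_dvd.1 hn
    exact le_ciSup hb m
  · intro ε hε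
    obtain ⟨i, hi⟩ := exists_lt_of_lt_ciSup (show (⨆ i : ℕ, f (2 * i)) - ε < ⨆ i : ℕ, f (2 * i) by
      linarith)
    refine ⟨2 * i, fun n hn he => ?_⟩
    obtain ⟨m, rfl⟩ := even_iff_two_dvd.1 he
    have := hmono (show i ≤ m by omega)
    simp only at this
    linarith

theorem exists_limit_odd (h : Oriented k c d f g) :
    ∃ O : ℝ, 0 ≤ O ∧ (∀ n, Odd n → O ≤ f n) ∧
      ∀ ε, 0 < ε → ∃ N, ∀ n, N ≤ n → Odd n → f n - O ≤ ε := by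
  obtain ⟨E, h1, h2, h3⟩ := h.shift_one_compl.exists_limit_even
  refine ⟨1 - E, by linarith, ?_, ?_⟩
  · rintro _ ⟨m, rfl⟩
    have := h2 (2 * m) (by simp)
    linarith
  · intro ε hε
    obtain ⟨N, hN⟩ := h3 ε hε
    refine ⟨N + 1, ?_⟩
    rintro _ hn ⟨m, rfl⟩
    have := hN (2 * m) (by omega) (by simp)
    linarith

end Oriented
end ITM

/-! ### Digits equal to one -/

namespace ITM
namespace RatioSystem

variable {k : ℕ → ℕ} {c d f g : ℕ → ℝ}

theorem d_add_two_eq (h : RatioSystem k c d f g) {n : ℕ} (hk : k (n + 2) = 1) :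
    d (n + 2) = d n := by
  rw [h.d_eq n, hk]
  simp

theorem d_add_le (h : RatioSystem k c d f g) (n j : ℕ) : d (n + 2 * j) ≤ d n := by
  induction j with
  | zero => simp
  | succ j ih => exact (h.d_add_two_le _).trans ih

theorem c_le_d (h : RatioSystem k c d f g) {n : ℕ} (hk : 2 ≤ k (n + 2)) : c (n + 2) ≤ d n := by
  have h1 := mul_le_mul_of_nonneg_right (one_le_k_sub hk) (h.c_pos (n + 2)).le
  linarith [h.d_eq n, h.d_pos (n + 2)]

theorem d_le (h : RatioSystem k c d f g) (n : ℕ) : d n ≤ k (n + 2) * c (n + 2) := by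
  linarith [h.d_eq n, h.c_eq (n + 2), h.c_pos (n + 3)]

/-- If `t` bounds `f (n+2)` and exceeds `f n` by at most `κ`, then the first sequence falls short of
the proportion `t` of `c (n+2)` by at most `2κ c (n+2)`. -/
theorem mass_le_of_two_le (h : RatioSystem k c d f g) {n : ℕ} {t κ : ℝ} (hk : 2 ≤ k (n + 2))
    (h1 : f (n + 2) ≤ t) (h2 : t - f n ≤ κ) (hκ : 0 ≤ κ) :
    c (n + 2) * (t - g (n + 2)) ≤ 2 * κ * c (n + 2) := by
  have hk1 := one_le_k_sub hk
  have e : d n * (t - f n) = d (n + 2) * (t - f (n + 2)) +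
      ((k (n + 2) : ℝ) - 1) * (c (n + 2) * (t - g (n + 2))) := by
    linear_combination t * h.d_eq n - h.df_eq n
  have e1 : d n * (t - f n) ≤ d n * κ := mul_le_mul_of_nonneg_left h2 (h.d_pos n).le
  have e2 := mul_nonneg (h.d_pos (n + 2)).le (sub_nonneg.2 h1)
  have e3 : d n ≤ ((k (n + 2) : ℝ) - 1) * (2 * c (n + 2)) := by
    nlinarith [h.d_le n, h.c_pos (n + 2)]
  have e4 := mul_le_mul_of_nonneg_right e3 hκ
  refine le_of_mul_le_mul_left ?_ (show (0 : ℝ) < (k (n + 2) : ℝ) - 1 by linarith)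
  linarith

/-- Along a run of ones `d` takes only two values, `y` and `x`, so that `c` decreases by `x + y` in
each two steps. -/
theorem run_of_ones (h : RatioSystem k c d f g) {n L : ℕ}
    (hone : ∀ i, 1 ≤ i → i < L → k (n + 2 + i) = 1) (j : ℕ) (hj : 2 * j + 2 ≤ L) :
    d (n + 2 + 2 * j) = d (n + 2) ∧ d (n + 3 + 2 * j) = d (n + 1) ∧
      c (n + 2) = c (n + 4 + 2 * j) + ((j : ℝ) + 1) * (d (n + 1) + d (n + 2)) := by
  induction j with
  | zero =>
    have h1 : d (n + 3) = d (n + 1) := h.d_add_two_eq (n := n + 1) (hone 1 le_rfl (by omega))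
    refine ⟨by simp, by simpa using h1, ?_⟩
    have h2 := h.c_eq (n + 2)
    have h3 := h.c_eq (n + 3)
    push_cast
    simp only [add_zero, zero_add, one_mul]
    linarith
  | succ j ih =>
    obtain ⟨i1, i2, i3⟩ := ih (by omega)
    have h1 : d (n + 2 + 2 * j + 2) = d (n + 2 + 2 * j) :=
      h.d_add_two_eq (by simpa [add_assoc] using hone (2 * j + 2) (by omega) (by omega))
    have h2 : d (n + 3 + 2 * j + 2) = d (n + 3 + 2 * j) := h.d_add_two_eq (by
      simpa [show n + 3 + 2 * j + 2 = n + 2 + (2 * j + 3) by ring] using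
        hone (2 * j + 3) (by omega) (by omega))
    have h3 := h.c_eq (n + 2 + 2 * j + 2)
    have h4 := h.c_eq (n + 3 + 2 * j + 2)
    refine ⟨by rw [← i1, ← h1]; ring_nf, by rw [← i2, ← h2]; ring_nf, ?_⟩
    rw [i3, show n + 4 + 2 * j = n + 2 + 2 * j + 2 by ring, h3,
      show n + 2 + 2 * j + 2 + 1 = n + 3 + 2 * j + 2 by ring, h4, h1, h2, i1, i2,
      show n + 3 + 2 * j + 2 + 1 = n + 4 + 2 * (j + 1) by ring]
    push_cast
    ring

end RatioSystem

namespace Oriented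

variable {k : ℕ → ℕ} {c d f g : ℕ → ℝ}

theorem g_le_limit (h : Oriented k c d f g) {E : ℝ} (hE : ∀ n, Even n → f n ≤ E) (n : ℕ) :
    g (n + 2) ≤ E := by
  rcases Nat.even_or_odd n with hn | hn
  · exact ((h.evenHigh n).1 hn).2.trans (hE _ hn)
  · exact ((h.evenHigh n).2 hn).2.trans (hE _ hn.add_one)

theorem limit_le_g (h : Oriented k c d f g) {O : ℝ} (hO : ∀ n, Odd n → O ≤ f n) (n : ℕ) :
    O ≤ g (n + 2) := by
  rcases Nat.even_or_odd n with hn | hn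
  · exact (hO _ hn.add_one).trans ((h.evenHigh n).1 hn).1
  · exact (hO _ hn).trans ((h.evenHigh n).2 hn).1

/-- Let `E > O` be the limits of the even and odd terms of `f`; then `X = c (E - g)` and
`Y = c (g - O)` measure the odd and the even part of `c`.  At an even index with `k ≥ 2` the odd part
is small compared with `c`, at an odd one the even part is.  A run of ones after an even index forces
`d (n+1) ≤ d (n+2)`; this keeps the odd part bounded by the even part at all smaller odd indices, up
to a constant, until one with `k ≥ 2` gives a contradiction. -/
theorem eventually_succ_ne_one_of_even (h : Oriented k c d f g) :
    ∃ N, ∀ n, N ≤ n → Even n → 2 ≤ k (n + 2) → k (n + 3) ≠ 1 := by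
  obtain ⟨E, hE1, hEf, hE⟩ := h.exists_limit_even
  obtain ⟨O, hO0, hOf, hO⟩ := h.exists_limit_odd
  obtain ⟨δ, hδ⟩ : ∃ δ, δ = f 0 - f 1 := ⟨_, rfl⟩
  have hδ0 : 0 < δ := by linarith [h.lt]
  have hδ1 : δ ≤ 1 := by linarith [h.f_le_one 0, h.f_nonneg 1]
  have hEO : δ ≤ E - O := by linarith [hEf 0 (by simp), hOf 1 (by simp)]
  obtain ⟨κ, hκ⟩ : ∃ κ, κ = δ ^ 2 / 16 := ⟨_, rfl⟩
  have hκ0 : 0 < κ := by rw [hκ]; positivity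
  have hκδ : 16 * κ ≤ δ := by rw [hκ]; nlinarith
  obtain ⟨N1, hN1⟩ := hE κ hκ0
  obtain ⟨N2, hN2⟩ := hO κ hκ0
  -- a large odd index with `k ≥ 2`
  obtain ⟨m0, hm0⟩ := h.freq (2 * (N1 + N2) + 3)
  obtain ⟨M, hM⟩ : ∃ M, M = 2 * (N1 + N2) + 1 + 2 * m0 := ⟨_, rfl⟩
  have hM2 : 2 ≤ k (M + 2) := by
    rw [hM, show 2 * (N1 + N2) + 1 + 2 * m0 + 2 = 2 * (N1 + N2) + 3 + 2 * m0 by ring]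
    exact hm0
  have hModd : Odd M := by rw [hM]; exact ⟨N1 + N2 + m0, by ring⟩
  refine ⟨M + 3, fun n hn hne hk2 hk1 => ?_⟩
  set X : ℕ → ℝ := fun n => c n * (E - g n) with hX
  set Y : ℕ → ℝ := fun n => c n * (g n - O) with hY
  have hXY : ∀ m, X m + Y m = c m * (E - O) := fun m => by simp only [hX, hY]; ring
  have hX0 : ∀ m, 0 ≤ X (m + 2) := fun m =>
    mul_nonneg (h.c_pos _).le (sub_nonneg.2 (h.g_le_limit hEf m))
  have hY0 : ∀ m, 0 ≤ Y (m + 2) := fun m =>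
    mul_nonneg (h.c_pos _).le (sub_nonneg.2 (h.limit_le_g hOf m))
  have hXs : ∀ m, X m = d m * (E - f m) + X (m + 1) := fun m => by
    simp only [hX]; linear_combination E * h.c_eq m - h.cg_eq m
  have hYs : ∀ m, Y m = d m * (f m - O) + Y (m + 1) := fun m => by
    simp only [hY]; linear_combination h.cg_eq m - O * h.c_eq m
  have hXodd : ∀ m, Odd m → δ * d m + X (m + 1) ≤ X m := fun m hm => by
    rw [hXs m, mul_comm δ]
    have : δ ≤ E - f m := by linarith [hEf 0 (by simp), h.odd_le_one hm]
    linarith [mul_le_mul_of_nonneg_left this (h.d_pos m).le]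
  have hXeven : ∀ m, Even m → X (m + 1) ≤ X m := fun m hm => by
    rw [hXs m]
    linarith [mul_nonneg (h.d_pos m).le (sub_nonneg.2 (hEf m hm))]
  have hYeven : ∀ m, Even m → δ * d m + Y (m + 1) ≤ Y m := fun m hm => by
    rw [hYs m, mul_comm δ]
    have : δ ≤ f m - O := by linarith [hOf 1 (by simp), h.zero_le_even hm]
    linarith [mul_le_mul_of_nonneg_left this (h.d_pos m).le]
  have hYodd : ∀ m, Odd m → Y (m + 1) ≤ Y m := fun m hm => by
    rw [hYs m]
    linarith [mul_nonneg (h.d_pos m).le (sub_nonneg.2 (hOf m hm))]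
  have hXp : X (n + 2) ≤ 2 * κ * c (n + 2) :=
    h.mass_le_of_two_le hk2 (hEf _ (hne.add (by simp))) (hN1 n (by omega) hne) hκ0.le
  -- the run of ones after `n + 2` gives `d (n+1) ≤ d (n+2)`
  have hxy : d (n + 1) ≤ d (n + 2) := by
    have hex : ∃ L, 1 ≤ L ∧ 2 ≤ k (n + 2 + L) := by
      obtain ⟨m, hm⟩ := h.freq (n + 3)
      exact ⟨1 + 2 * m, by omega, by rwa [show n + 2 + (1 + 2 * m) = n + 3 + 2 * m by ring]⟩
    classical
    set L := Nat.find hex with hL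
    obtain ⟨hL1, hL2⟩ := Nat.find_spec hex
    rw [← hL] at hL1 hL2
    have hone : ∀ i, 1 ≤ i → i < L → k (n + 2 + i) = 1 := fun i hi hiL => by
      have := h.k_pos (n + 2 + i)
      by_contra hc
      exact Nat.find_min hex hiL ⟨hi, by omega⟩
    have hL3 : 2 ≤ L := by
      by_contra hc
      have : L = 1 := by omega
      rw [this, show n + 2 + 1 = n + 3 by ring] at hL2
      omega
    have hrun := h.run_of_ones hone
    have hXrun : ∀ j, 2 * j + 2 ≤ L → ((j : ℝ) + 1) * (δ * d (n + 1)) ≤ X (n + 2) := by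
      have key : ∀ j, 2 * j + 2 ≤ L →
          ((j : ℝ) + 1) * (δ * d (n + 1)) + X (n + 4 + 2 * j) ≤ X (n + 2) := by
        intro j
        induction j with
        | zero =>
          intro hj
          have h1 := hXeven (n + 2) (hne.add (by simp))
          have h2 := hXodd (n + 2 + 1) ((hne.add (by simp)).add_one)
          have h3 := (hrun 0 hj).2.1
          simp only [mul_zero, add_zero] at h3
          simp only [show n + 2 + 1 = n + 3 by ring, show n + 3 + 1 = n + 4 by ring] at h1 h2
          rw [h3] at h2
          simp only [mul_zero, add_zero, Nat.cast_zero, zero_add, one_mul]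
          linarith
        | succ j ih =>
          intro hj
          have h0 := ih (by omega)
          have hev : Even (n + 4 + 2 * j) := (hne.add (by decide)).add (even_two_mul j)
          have h1 := hXeven _ hev
          have h2 := hXodd _ hev.add_one
          have h3 := (hrun (j + 1) hj).2.1
          rw [show n + 3 + 2 * (j + 1) = n + 4 + 2 * j + 1 by ring] at h3
          rw [h3, show n + 4 + 2 * j + 1 + 1 = n + 4 + 2 * (j + 1) by ring] at h2
          push_cast
          linarith
      intro j hj
      have := hX0 (n + 2 + 2 * j)
      rw [show n + 2 + 2 * j + 2 = n + 4 + 2 * j by ring] at this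
      linarith [key j hj]
    obtain ⟨j, hj⟩ : ∃ j, L = 2 * j + 2 ∨ L = 2 * j + 3 := ⟨(L - 2) / 2, by omega⟩
    have hjL : 2 * j + 2 ≤ L := by omega
    obtain ⟨r1, r2, r3⟩ := hrun j hjL
    have hx := h.d_pos (n + 1)
    have hy := h.d_pos (n + 2)
    have hcq : c (n + 4 + 2 * j) ≤ d (n + 1) + d (n + 2) := by
      rcases hj with hj | hj
      · have := h.c_le_d (n := n + 2 + 2 * j) (by
          rwa [show n + 2 + 2 * j + 2 = n + 2 + L by rw [hj]; ring])
        rw [r1, show n + 2 + 2 * j + 2 = n + 4 + 2 * j by ring] at this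
        linarith
      · have h1 := h.c_le_d (n := n + 3 + 2 * j) (by
          rwa [show n + 3 + 2 * j + 2 = n + 2 + L by rw [hj]; ring])
        have h2 := h.d_add_two_eq (n := n + 2 + 2 * j) (by
          rw [show n + 2 + 2 * j + 2 = n + 2 + (2 * j + 2) by ring]
          exact hone _ (by omega) (by omega))
        have h3 := h.c_eq (n + 4 + 2 * j)
        rw [show n + 2 + 2 * j + 2 = n + 4 + 2 * j by ring] at h2
        rw [show n + 3 + 2 * j + 2 = n + 4 + 2 * j + 1 by ring] at h1
        linarith
    have hXr := hXrun j hjL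
    have hj0 : (0 : ℝ) ≤ j := Nat.cast_nonneg j
    have hcp : c (n + 2) ≤ 2 * (((j : ℝ) + 1) * (d (n + 1) + d (n + 2))) := by
      rw [r3]
      nlinarith
    have h5 : ((j : ℝ) + 1) * (δ * d (n + 1)) ≤
        ((j : ℝ) + 1) * (4 * κ * (d (n + 1) + d (n + 2))) := by
      have := mul_le_mul_of_nonneg_left hcp (show 0 ≤ 2 * κ by linarith)
      linarith
    have h6 := le_of_mul_le_mul_left h5 (by linarith)
    have h7 : 4 * κ * (d (n + 1) + d (n + 2)) ≤ δ / 4 * (d (n + 1) + d (n + 2)) :=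
      mul_le_mul_of_nonneg_right (by linarith) (by linarith)
    have h8 : δ * d (n + 1) ≤ δ * ((d (n + 1) + d (n + 2)) / 4) := by linarith
    linarith [le_of_mul_le_mul_left h8 hδ0]
  -- going down from `n + 2`, the odd mass stays comparable with the even one, so no odd `k` is `≥ 2`
  obtain ⟨K, hK⟩ : ∃ K, K = 1 + 2 / δ := ⟨_, rfl⟩
  have hKδ : K * δ = δ + 2 := by rw [hK]; field_simp
  have hK0 : 0 < K := by rw [hK]; positivity
  have hXpY : X (n + 2) ≤ Y (n + 2) := by
    have h1 := hXY (n + 2)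
    have h2 : c (n + 2) * δ ≤ c (n + 2) * (E - O) :=
      mul_le_mul_of_nonneg_left hEO (h.c_pos _).le
    have h3 : 16 * κ * c (n + 2) ≤ δ * c (n + 2) :=
      mul_le_mul_of_nonneg_right hκδ (h.c_pos _).le
    have := mul_pos hκ0 (h.c_pos (n + 2))
    linarith
  have hbig : ∀ m, M ≤ m → Odd m → 2 ≤ k (m + 2) → ¬ X (m + 2) ≤ K * Y (m + 2) := by
    intro m hm ho hk i1
    have h1 := h.compl.mass_le_of_two_le (n := m) (t := 1 - O) (κ := κ) hk
      (by linarith [hOf (m + 2) (ho.add_even (by simp))])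
      (by linarith [hN2 m (by omega) ho]) hκ0.le
    have h2 : Y (m + 2) ≤ 2 * κ * c (m + 2) := by
      simp only [hY]
      linarith
    have h3 := hXY (m + 2)
    have h4 : c (m + 2) * δ ≤ c (m + 2) * (E - O) :=
      mul_le_mul_of_nonneg_left hEO (h.c_pos _).le
    have h6 : (K + 1) * Y (m + 2) ≤ (K + 1) * (2 * κ * c (m + 2)) :=
      mul_le_mul_of_nonneg_left h2 (by linarith)
    have h7 : (K + 1) * (2 * κ) ≤ δ / 2 := by
      rw [hκ, show (K + 1) * (2 * (δ ^ 2 / 16)) = (K * δ + δ) * δ / 8 by ring, hKδ]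
      nlinarith
    have h8 := mul_le_mul_of_nonneg_right h7 (h.c_pos (m + 2)).le
    linarith [mul_pos (h.c_pos (m + 2)) hδ0]
  have hdown : ∀ i m, m + 2 + 2 * i = n + 1 → M ≤ m →
      X (m + 2) ≤ K * Y (m + 2) ∧ d (m + 2) = d (n + 1) := by
    intro i
    induction i with
    | zero =>
      intro m hm hMm
      have e : m + 2 = n + 1 := by omega
      rw [e]
      refine ⟨?_, rfl⟩
      have h1 := hXs (n + 1)
      have h2 := hYodd (n + 1) hne.add_one
      have h3 := hYeven (n + 2) (hne.add (by simp))
      have h4 : 0 ≤ Y (n + 2 + 1) := hY0 (n + 1)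
      have h5 : d (n + 1) * (E - f (n + 1)) ≤ d (n + 1) * 1 :=
        mul_le_mul_of_nonneg_left (by linarith [h.f_nonneg (n + 1)]) (h.d_pos _).le
      simp only [show n + 1 + 1 = n + 2 by ring] at h1 h2
      have h6 : (1 + δ) * d (n + 2) ≤ (K * δ) * d (n + 2) :=
        mul_le_mul_of_nonneg_right (by linarith) (h.d_pos _).le
      have h7 : K * (δ * d (n + 2)) ≤ K * Y (n + 2) :=
        mul_le_mul_of_nonneg_left (by linarith) hK0.le
      have h8 : K * Y (n + 2) ≤ K * Y (n + 1) := mul_le_mul_of_nonneg_left h2 hK0.le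
      have h11 : d (n + 2) ≤ (1 / δ) * Y (n + 2) := by
        rw [one_div, inv_mul_eq_div, le_div_iff₀ hδ0]; linarith
      have h12 : K * Y (n + 2) = Y (n + 2) + 2 * ((1 / δ) * Y (n + 2)) := by rw [hK]; ring
      have h13 : 0 ≤ (1 / δ) * Y (n + 2) := by linarith [h.d_pos (n + 2)]
      linarith
    | succ i ih =>
      intro m hm hMm
      obtain ⟨i1, i2⟩ := ih (m + 2) (by omega) (by omega)
      have hmo : Odd m := by
        obtain ⟨a, ha⟩ := hne
        exact ⟨a - i - 2, by omega⟩
      -- `k (m+4) = 1`, as otherwise the even mass would be small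
      have hk4 : k (m + 2 + 2) = 1 := by
        have := h.k_pos (m + 2 + 2)
        by_contra hc
        exact hbig (m + 2) (by omega) (hmo.add_even (by simp)) (by omega) i1
      have hd : d (m + 2) = d (n + 1) := by rw [← i2, h.d_add_two_eq hk4]
      refine ⟨?_, hd⟩
      have ho : Odd (m + 2) := hmo.add_even (by simp)
      have h1 := hXs (m + 2)
      have h2 := hXs (m + 2 + 1)
      have h3 := hYodd (m + 2) ho
      have h4 := hYeven (m + 2 + 1) ho.add_one
      have h5 : d (m + 2) * (E - f (m + 2)) ≤ d (m + 2) * 1 :=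
        mul_le_mul_of_nonneg_left (by linarith [h.f_nonneg (m + 2)]) (h.d_pos _).le
      have h6 : d (m + 3) * (E - f (m + 3)) ≤ d (m + 3) * δ := by
        refine mul_le_mul_of_nonneg_left ?_ (h.d_pos _).le
        linarith [hN1 (m + 3) (by omega) ho.add_one]
      have h7 : d (n + 2) ≤ d (m + 3) := by
        have := h.d_add_le (m + 3) (i + 1)
        rwa [show m + 3 + 2 * (i + 1) = n + 2 by omega] at this
      simp only [show m + 2 + 1 = m + 3 by ring, show m + 3 + 1 = m + 4 by ring] at *
      have h8 : K * (δ * d (m + 3) + Y (m + 4)) ≤ K * Y (m + 2) :=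
        mul_le_mul_of_nonneg_left (by linarith) hK0.le
      have h9 : K * (δ * d (m + 3)) = (δ + 2) * d (m + 3) := by rw [← hKδ]; ring
      have h10 := h.d_pos (m + 3)
      linarith
  -- contradiction at the large odd index `M + 2`
  obtain ⟨a, ha⟩ := hne
  obtain ⟨b, hb⟩ := hModd
  obtain ⟨i1, -⟩ := hdown (a - b - 1) M (by omega) le_rfl
  exact hbig M le_rfl ⟨b, hb⟩ hM2 i1

end Oriented
end ITM

/-! ### Summable ratios -/

namespace ITM
namespace Oriented

variable {k : ℕ → ℕ} {c d f g : ℕ → ℝ}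

/-- A digit `≥ 2` is eventually never followed by a digit `1`. -/
theorem two_le_eventually (h : Oriented k c d f g) : ∃ N, ∀ n, N ≤ n → 2 ≤ k n := by
  obtain ⟨N1, h1⟩ := h.eventually_succ_ne_one_of_even
  obtain ⟨N2, h2⟩ := h.shift_one_compl.eventually_succ_ne_one_of_even
  obtain ⟨m, hm⟩ := h.freq (N1 + N2 + 3)
  refine ⟨N1 + N2 + 3 + 2 * m, fun n hn => ?_⟩
  induction n, hn using Nat.le_induction with
  | base => exact hm
  | succ n hn ih =>
    have hpos := h.k_pos (n + 1)
    suffices k (n + 1) ≠ 1 by omega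
    obtain ⟨p, rfl⟩ : ∃ p, n = p + 3 := ⟨n - 3, by omega⟩
    rcases Nat.even_or_odd p with hp | hp
    · exact h2 p (by omega) hp ih
    · exact h1 (p + 1) (by omega) hp.add_one ih

/-- When all `k n ≥ 2`, the gap between consecutive `f`'s of the same parity controls the ratio
`c (n+1) / c n`. -/
theorem summable_ratio_even (h : Oriented k c d f g) (hk : ∀ n, 2 ≤ k n) :
    Summable fun i : ℕ => c (2 * i + 1) / c (2 * i) := by
  obtain ⟨O, hO0, hOf, hO⟩ := h.exists_limit_odd
  obtain ⟨δ, hδ⟩ : ∃ δ, δ = f 0 - f 1 := ⟨_, rfl⟩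
  have hδ0 : 0 < δ := by linarith [h.lt]
  obtain ⟨N, hN⟩ := hO (δ / 4) (by positivity)
  -- consecutive values of `f` bound the distance of `g` to `f`
  have hstep : ∀ n, Even n → f (n + 2) - g (n + 2) ≤ 2 * (f (n + 2) - f n) := by
    intro n hn
    have e : d n * (f (n + 2) - f n) =
        ((k (n + 2) : ℝ) - 1) * c (n + 2) * (f (n + 2) - g (n + 2)) := by
      linear_combination f (n + 2) * h.d_eq n - h.df_eq n
    have h1 := RatioSystem.one_le_k_sub (hk (n + 2))
    have h2 := h.d_le n
    have h3 := h.c_pos (n + 2)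
    have h4 : d n ≤ 2 * (((k (n + 2) : ℝ) - 1) * c (n + 2)) := by nlinarith
    have h5 := mul_le_mul_of_nonneg_right h4 (sub_nonneg.2 (h.even_le hn))
    refine le_of_mul_le_mul_left ?_
      (show 0 < ((k (n + 2) : ℝ) - 1) * c (n + 2) from mul_pos (by linarith) h3)
    linarith
  have hstep' : ∀ n, Odd n → g (n + 2) - f (n + 2) ≤ 2 * (f n - f (n + 2)) := by
    intro n hn
    have e : d n * (f n - f (n + 2)) =
        ((k (n + 2) : ℝ) - 1) * c (n + 2) * (g (n + 2) - f (n + 2)) := by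
      linear_combination h.df_eq n - f (n + 2) * h.d_eq n
    have h1 := RatioSystem.one_le_k_sub (hk (n + 2))
    have h2 := h.d_le n
    have h3 := h.c_pos (n + 2)
    have h4 : d n ≤ 2 * (((k (n + 2) : ℝ) - 1) * c (n + 2)) := by nlinarith
    have h5 := mul_le_mul_of_nonneg_right h4 (sub_nonneg.2 (h.odd_le hn))
    refine le_of_mul_le_mul_left ?_
      (show 0 < ((k (n + 2) : ℝ) - 1) * c (n + 2) from mul_pos (by linarith) h3)
    linarith
  have hbound : ∀ n, N ≤ n → Even n → c (n + 3) / c (n + 2) ≤ 4 / δ * (f (n + 2) - f n) := by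
    intro n hn he
    have h1 := hstep n he
    have h2 := hstep' (n + 1) he.add_one
    have h3 : f (n + 1) - f (n + 3) ≤ δ / 4 := by
      linarith [hN (n + 1) (by omega) he.add_one, hOf (n + 3) (he.add_one.add_even even_two)]
    have h4 : δ / 2 ≤ f (n + 2) - g (n + 3) := by
      linarith [h.zero_le_even (he.add even_two),
        h.odd_le_one (he.add_one.add_even even_two : Odd (n + 3))]
    have e : c (n + 2) * (f (n + 2) - g (n + 2)) = c (n + 3) * (f (n + 2) - g (n + 3)) := by
      linear_combination f (n + 2) * h.c_eq (n + 2) - h.cg_eq (n + 2)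
    have h5 := mul_le_mul_of_nonneg_left h4 (h.c_pos (n + 3)).le
    have h6 := mul_le_mul_of_nonneg_left h1 (h.c_pos (n + 2)).le
    rw [div_le_iff₀ (h.c_pos _)]
    have h7 : c (n + 3) * δ ≤ 4 * (f (n + 2) - f n) * c (n + 2) := by linarith
    calc c (n + 3) ≤ 4 * (f (n + 2) - f n) * c (n + 2) / δ := by rwa [le_div_iff₀ hδ0]
      _ = _ := by ring
  have hsum : Summable fun i : ℕ => 4 / δ * (f (2 * (i + 1)) - f (2 * i)) := by
    refine Summable.mul_left _ (summable_of_sum_range_le (c := 1) (fun i => ?_) fun n => ?_)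
    · exact sub_nonneg.2 (h.even_le (even_two_mul i))
    · rw [Finset.sum_range_sub (fun i => f (2 * i))]
      linarith [h.f_le_one (2 * n), h.f_nonneg (2 * 0)]
  rw [← summable_nat_add_iff 1]
  refine Summable.of_norm_bounded_eventually_nat hsum ?_
  filter_upwards [eventually_ge_atTop N] with i hi
  rw [Real.norm_of_nonneg (div_nonneg (h.c_pos _).le (h.c_pos _).le)]
  have := hbound (2 * i) (by omega) (even_two_mul i)
  simpa only [show 2 * (i + 1) = 2 * i + 2 by ring] using this

theorem summable_ratio (h : Oriented k c d f g) (hk : ∀ n, 2 ≤ k n) :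
    Summable fun n => c (n + 1) / c n := by
  obtain ⟨a, ha⟩ := h.summable_ratio_even hk
  obtain ⟨b, hb⟩ := h.shift_one_compl.summable_ratio_even fun n => hk _
  exact (HasSum.even_add_odd (f := fun n => c (n + 1) / c n) ha hb).summable

/-- The orientation survives even shifts; the strict inequality persists by monotonicity. -/
theorem shift_even (h : Oriented k c d f g) (j : ℕ) :
    Oriented (fun n => k (n + 2 * j)) (fun n => c (n + 2 * j)) (fun n => d (n + 2 * j))
      (fun n => f (n + 2 * j)) (fun n => g (n + 2 * j)) where
  toRatioSystem := h.shift _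
  evenHigh _ := (h.evenHigh _).shift
  lt := by
    have h1 := h.zero_le_even (even_two_mul j)
    have h2 := h.odd_le_one (n := 1 + 2 * j) ⟨j, by ring⟩
    simp only [zero_add]
    linarith [h.lt]

theorem summable_ratio_shift (h : Oriented k c d f g) :
    ∃ N, (∀ n, N ≤ n → 2 ≤ k n) ∧ Summable fun n => c (n + 1) / c n := by
  obtain ⟨N, hN⟩ := h.two_le_eventually
  refine ⟨N, hN, ?_⟩
  have := (h.shift_even N).summable_ratio fun n => hN _ (by omega)
  rw [← summable_nat_add_iff (2 * N)]
  simpa only [show ∀ n, n + 2 * N + 1 = n + 1 + 2 * N from fun n => by ring] using this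

end Oriented

namespace RatioSystem

variable {k : ℕ → ℕ} {c d f g : ℕ → ℝ}

theorem g_const_of_f_const (h : RatioSystem k c d f g) {t : ℝ} (hf : ∀ n, f n = t) (n : ℕ) :
    g n = t := by
  -- `c * (g - t)` is constant, and it vanishes wherever `k ≥ 2`
  have h1 : ∀ m, c m * (g m - t) = c (m + 1) * (g (m + 1) - t) := fun m => by
    have := h.cg_eq m
    rw [hf] at this
    linear_combination this - t * h.c_eq m
  have h2 : ∀ m, c n * (g n - t) = c (n + m) * (g (n + m) - t) := by
    intro m
    induction m with
    | zero => rfl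
    | succ m ih => rw [ih, h1]; rfl
  obtain ⟨m, hm⟩ := h.freq (n + 2)
  have h3 := h.df_eq (n + 2 * m)
  have h4 := h.d_eq (n + 2 * m)
  rw [hf, hf] at h3
  have h5 := one_le_k_sub (n := n + 2 * m + 2) (by
    rwa [show n + 2 * m + 2 = n + 2 + 2 * m by ring])
  have h6 : ((k (n + 2 * m + 2) : ℝ) - 1) *
      (c (n + 2 * m + 2) * (g (n + 2 * m + 2) - t)) = 0 := by
    linear_combination t * h4 - h3
  have h7 := (mul_eq_zero.1 h6).resolve_left (by linarith)
  have h8 := h2 (2 * m + 2)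
  rw [← add_assoc, h7] at h8
  exact sub_eq_zero.1 ((mul_eq_zero.1 h8).resolve_left (h.c_pos n).ne')

theorem const_or_summable_of_evenHigh (h : RatioSystem k c d f g) (he : ∀ n, EvenHigh f g n) :
    (∃ t, ∀ n, g n = t) ∨ ∃ N, (∀ n, N ≤ n → 2 ≤ k n) ∧ Summable fun n => c (n + 1) / c n := by
  by_cases hall : ∃ j, f (1 + 2 * j) < f (0 + 2 * j)
  · obtain ⟨j, hj⟩ := hall
    right
    have ho : Oriented (fun n => k (n + 2 * j)) (fun n => c (n + 2 * j)) (fun n => d (n + 2 * j))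
        (fun n => f (n + 2 * j)) (fun n => g (n + 2 * j)) :=
      { toRatioSystem := h.shift _
        evenHigh := fun n => (he _).shift
        lt := hj }
    obtain ⟨N, hN, hs⟩ := ho.summable_ratio_shift
    refine ⟨N + 2 * j, fun n hn => ?_, ?_⟩
    · have := hN (n - 2 * j) (by omega)
      rwa [Nat.sub_add_cancel (by omega)] at this
    · rw [← summable_nat_add_iff (2 * j)]
      simpa only [show ∀ n, n + 2 * j + 1 = n + 1 + 2 * j from fun n => by ring] using hs
  · push Not at hall
    have heven : ∀ j, f 0 ≤ f (0 + 2 * j) := by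
      intro j
      induction j with
      | zero => simp
      | succ j ih => exact ih.trans (h.le_f_add_two ((he (0 + 2 * j)).1 (by simp)).2)
    have hodd : ∀ j, f (1 + 2 * j) ≤ f 1 := by
      intro j
      induction j with
      | zero => simp
      | succ j ih =>
        exact (h.f_add_two_le ((he (1 + 2 * j)).2 ⟨j, by ring⟩).1).trans ih
    have h10 : f 1 ≤ f 0 := ((he 0).1 (by simp)).1.trans ((he 0).1 (by simp)).2
    refine Or.inl ⟨f 0, h.g_const_of_f_const fun n => ?_⟩
    obtain ⟨j, rfl | rfl⟩ : ∃ j, n = 0 + 2 * j ∨ n = 1 + 2 * j := ⟨n / 2, by omega⟩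
    · linarith [heven j, hodd j, hall j]
    · linarith [heven j, hodd j, hall j]

/-- **Dichotomy**: either the two solutions behind the ratios are proportional, or `k` is eventually
at least `2` and `c (n+1) / c n` is summable. -/
theorem const_or_summable (h : RatioSystem k c d f g) :
    (∃ t, ∀ n, g n = t) ∨ ∃ N, (∀ n, N ≤ n → 2 ≤ k n) ∧ Summable fun n => c (n + 1) / c n := by
  rcases h.evenHigh_or with he | he
  · exact h.const_or_summable_of_evenHigh he
  · rcases h.compl.const_or_summable_of_evenHigh he with ⟨t, ht⟩ | hs
    · exact Or.inl ⟨1 - t, fun n => by linarith [ht n]⟩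
    · exact Or.inr hs

end RatioSystem
end ITM

/-! ### The four conditions -/

namespace ITM

/-- The masses of the third branches under the successive renormalizations of an invariant measure. -/
structure MassSequence (k : ℕ → ℕ) (c : ℕ → ℝ) : Prop where
  nonneg : ∀ n, 0 ≤ c n
  succ_le : ∀ n, c (n + 1) ≤ c n
  rec_eq : ∀ n, c n - c (n + 1) = c (n + 2) - c (n + 3) + ((k (n + 2) : ℝ) - 1) * c (n + 2)

namespace MassSequence

variable {k : ℕ → ℕ} {c c' : ℕ → ℝ}

theorem add (h : MassSequence k c) (h' : MassSequence k c') :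
    MassSequence k (fun n => c n + c' n) where
  nonneg n := add_nonneg (h.nonneg n) (h'.nonneg n)
  succ_le n := add_le_add (h.succ_le n) (h'.succ_le n)
  rec_eq n := by linear_combination h.rec_eq n + h'.rec_eq n

theorem pos (h : MassSequence k c) (h0 : 0 < c 0) (n : ℕ) : 0 < c n := by
  induction n with
  | zero => exact h0
  | succ n ih =>
    by_contra hc
    have h1 : c (n + 1) = 0 := le_antisymm (not_lt.1 hc) (h.nonneg _)
    have h2 : c (n + 2) = 0 := le_antisymm (h1 ▸ h.succ_le (n + 1)) (h.nonneg _)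
    have h3 : c (n + 3) = 0 := le_antisymm (h2 ▸ h.succ_le (n + 2)) (h.nonneg _)
    have h4 := h.rec_eq n
    rw [h1, h2, h3] at h4
    linarith

theorem sub_pos (h : MassSequence k c) (hk : ∀ n, 1 ≤ k n) (hf : ∀ n, ∃ m, 2 ≤ k (n + 2 * m))
    (h0 : 0 < c 0) (n : ℕ) : 0 < c n - c (n + 1) := by
  have hmono : ∀ j, c (n + 2 * j) - c (n + 2 * j + 1) ≤ c n - c (n + 1) := by
    intro j
    induction j with
    | zero => simp
    | succ j ih =>
      have h1 : (1 : ℝ) ≤ k (n + 2 * j + 2) := by exact_mod_cast hk _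
      have := mul_nonneg (sub_nonneg.2 h1) (h.nonneg (n + 2 * j + 2))
      have := h.rec_eq (n + 2 * j)
      rw [show n + 2 * (j + 1) = n + 2 * j + 2 by ring]
      linarith
  obtain ⟨m, hm⟩ := hf (n + 2)
  rw [show n + 2 + 2 * m = n + 2 * m + 2 by ring] at hm
  have h2 : (2 : ℝ) ≤ k (n + 2 * m + 2) := by exact_mod_cast hm
  have h3 := h.pos h0 (n + 2 * m + 2)
  have h4 : 0 < ((k (n + 2 * m + 2) : ℝ) - 1) * c (n + 2 * m + 2) := mul_pos (by linarith) h3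
  linarith [h.rec_eq (n + 2 * m), hmono m, h.succ_le (n + 2 * m + 2)]

/-- Two mass sequences give the ratio system of the first one relative to their sum. -/
theorem ratioSystem (h : MassSequence k c) (h' : MassSequence k c') (hk : ∀ n, 1 ≤ k n)
    (hf : ∀ n, ∃ m, 2 ≤ k (n + 2 * m)) (h0 : 0 < c 0 + c' 0) :
    RatioSystem k (fun n => c n + c' n) (fun n => c n + c' n - (c (n + 1) + c' (n + 1)))
      (fun n => (c n - c (n + 1)) / (c n + c' n - (c (n + 1) + c' (n + 1))))
      (fun n => c n / (c n + c' n)) := by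
  have hs := h.add h'
  have hcp : ∀ n, 0 < c n + c' n := hs.pos h0
  have hdp : ∀ n, 0 < c n + c' n - (c (n + 1) + c' (n + 1)) := hs.sub_pos hk hf h0
  refine ⟨hk, hf, hcp, hdp, fun n => by ring, fun n => ?_, fun n => ?_, fun n => ?_, fun n => ?_,
    fun n => ?_, fun n => ?_, fun n => ?_⟩
  · linear_combination hs.rec_eq n
  · rw [mul_div_cancel₀ _ (hcp n).ne', mul_div_cancel₀ _ (hcp _).ne',
      mul_div_cancel₀ _ (hdp n).ne']
    ring
  · rw [mul_div_cancel₀ _ (hdp n).ne', mul_div_cancel₀ _ (hcp _).ne',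
      mul_div_cancel₀ _ (hdp _).ne']
    linear_combination h.rec_eq n
  · exact div_nonneg (sub_nonneg.2 (h.succ_le n)) (hdp n).le
  · exact (div_le_one (hdp n)).2 (by linarith [h'.succ_le n])
  · exact div_nonneg (h.nonneg n) (hcp n).le
  · exact (div_le_one (hcp n)).2 (by linarith [h'.nonneg n])

/-- No knowledge of the gap is needed: the junk value `gap = 0` makes the left-hand side zero. -/
theorem sumTerm_le (k : ℕ → ℕ) (n : ℕ) : sumTerm k n ≤ Real.sqrt (1 / (k (n - 1) : ℝ)) := by
  unfold sumTerm
  have h1 : ((k n : ℝ) - 1) / k n ≤ 1 := div_le_one_of_le₀ (by linarith) (Nat.cast_nonneg _)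
  have h2 : 1 / ((k (n - 1) : ℝ) * (gap k n : ℝ)) ≤ 1 / (k (n - 1) : ℝ) := by
    rcases Nat.eq_zero_or_pos (gap k n) with hg | hg
    · rw [hg]; simp
    · rcases Nat.eq_zero_or_pos (k (n - 1)) with hk | hk
      · rw [hk]; simp
      · have h3 : (1 : ℝ) ≤ gap k n := by exact_mod_cast hg
        have h4 : (0 : ℝ) < k (n - 1) := by exact_mod_cast hk
        exact one_div_le_one_div_of_le h4 (le_mul_of_one_le_right h4.le h3)
  calc _ ≤ 1 * Real.sqrt (1 / ((k (n - 1) : ℝ) * (gap k n : ℝ))) :=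
        mul_le_mul_of_nonneg_right h1 (Real.sqrt_nonneg _)
    _ ≤ _ := by rw [one_mul]; exact Real.sqrt_le_sqrt h2

theorem sumTerm_nonneg {k : ℕ → ℕ} (hk : ∀ n, 1 ≤ k n) (n : ℕ) : 0 ≤ sumTerm k n := by
  have : (1 : ℝ) ≤ k n := by exact_mod_cast hk n
  exact mul_nonneg (div_nonneg (by linarith) (Nat.cast_nonneg _)) (Real.sqrt_nonneg _)

theorem le_prodTerm {k : ℕ → ℕ} (hk : ∀ n, 1 ≤ k n) (n : ℕ) :
    (k n : ℝ) / ((k (n - 1) : ℝ) + 1) ≤ prodTerm k n := by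
  have h1 : (1 : ℝ) ≤ k (n - 1) := by exact_mod_cast hk (n - 1)
  have h2 : 1 / (gap k n : ℝ) ≤ 1 := by
    rcases Nat.eq_zero_or_pos (gap k n) with hg | hg
    · rw [hg]; simp
    · exact div_le_one_of_le₀ (by exact_mod_cast hg) (Nat.cast_nonneg _)
  have h3 : 0 ≤ 1 / (gap k n : ℝ) := by positivity
  exact div_le_div_of_nonneg_left (Nat.cast_nonneg _) (by linarith) (by linarith)

variable (hk : ∀ n, 1 ≤ k n) (h : MassSequence k c) (hpos : ∀ n, 0 < c n)
  {N : ℕ} (hN : ∀ n, N ≤ n → 2 ≤ k n) (hs : Summable fun n => c (n + 1) / c n)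

include h hpos hs in
theorem summable_sqrt_one_div : Summable fun n => Real.sqrt (1 / (k n : ℝ)) := by
  have hr0 : ∀ n, 0 ≤ c (n + 1) / c n := fun n => div_nonneg (hpos _).le (hpos _).le
  have hs2 := hs.add ((summable_nat_add_iff 1).2 hs)
  rw [← summable_nat_add_iff 2]
  refine Summable.of_norm_bounded_eventually_nat hs2 ?_
  filter_upwards [hs.tendsto_atTop_zero.eventually (gt_mem_nhds (show (0 : ℝ) < 1 / 2 by norm_num))]
    with n hn
  rw [Real.norm_of_nonneg (Real.sqrt_nonneg _), Real.sqrt_le_left (add_nonneg (hr0 _) (hr0 _))]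
  have h1 : c (n + 1) ≤ 1 / 2 * c n := ((div_lt_iff₀ (hpos n)).1 hn).le
  have h2 := h.rec_eq n
  have h3 := h.nonneg (n + 3)
  have h4 : c n ≤ 2 * (k (n + 2) * c (n + 2)) := by linarith
  have hk0 : (0 : ℝ) < k (n + 2) := by
    by_contra hc
    have := mul_nonneg (not_lt.1 hc |> neg_nonneg.2) (hpos (n + 2)).le
    linarith [hpos n]
  have h5 : 1 / (k (n + 2) : ℝ) ≤ 2 * (c (n + 1) / c n * (c (n + 2) / c (n + 1))) := by
    rw [div_mul_div_comm, mul_comm (c (n + 1)), mul_div_mul_right _ _ (hpos (n + 1)).ne',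
      div_le_iff₀ hk0, ← mul_div_assoc, div_mul_eq_mul_div, le_div_iff₀ (hpos n)]
    linarith
  refine h5.trans ?_
  nlinarith [sq_nonneg (c (n + 1) / c n), sq_nonneg (c (n + 2) / c (n + 1))]

include hk h hpos hs in
theorem not_tendsto_sum {e : ℕ → ℕ} (he : ∀ i, 1 ≤ i → e (i + 1) = e i + 2) :
    ¬ Tendsto (fun N : ℕ => ∑ i ∈ Finset.Icc 1 N, sumTerm k (e i)) atTop atTop := by
  have h1 := summable_sqrt_one_div h hpos hs
  have hinj : ∀ i, e (i + 1) = e 1 + 2 * i := by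
    intro i
    induction i with
    | zero => rfl
    | succ i ih => rw [he _ (by omega), ih]; ring
  have h2 : Summable fun i => sumTerm k (e i) := by
    rw [← summable_nat_add_iff 2]
    have h3 : Function.Injective fun i : ℕ => e (i + 2) - 1 := fun i j hij => by
      have := hinj (i + 1)
      have := hinj (j + 1)
      simp only [add_assoc, Nat.reduceAdd] at *
      omega
    exact Summable.of_nonneg_of_le (fun i => sumTerm_nonneg hk _) (fun i => sumTerm_le k _)
      (h1.comp_injective h3)
  intro ht
  have hb : ∀ M : ℕ, ∑ i ∈ Finset.Icc 1 M, sumTerm k (e i) ≤ ∑' i, sumTerm k (e i) := fun M =>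
    h2.sum_le_tsum _ fun i _ => sumTerm_nonneg hk _
  obtain ⟨M, hM⟩ := (ht.eventually_gt_atTop (∑' i, sumTerm k (e i))).exists
  exact absurd (hb M) (not_le.2 hM)

include hk h hpos in
/-- The terms of the product almost telescope along the ratios `c (n+1) / c n`. -/
theorem mul_le_prodTerm {n : ℕ} (hn : 2 ≤ k (n + 3)) :
    (1 - c (n + 2) / c (n + 1)) * (c (n + 1) / c n) / (c (n + 3) / c (n + 2)) ≤
      prodTerm k (n + 3) := by
  refine le_trans ?_ (le_prodTerm hk (n + 3))
  have p0 := hpos n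
  have p1 := hpos (n + 1)
  have p2 := hpos (n + 2)
  have p3 := hpos (n + 3)
  have r0 := h.rec_eq n
  have r1 := h.rec_eq (n + 1)
  simp only [show n + 1 + 1 = n + 2 by ring, show n + 1 + 2 = n + 3 by ring,
    show n + 1 + 3 = n + 4 by ring] at r1
  have s1 := h.succ_le (n + 1)
  have s3 := h.succ_le (n + 3)
  have p4 := h.nonneg (n + 4)
  have hk3 : (2 : ℝ) ≤ k (n + 3) := by exact_mod_cast hn
  have hk2 : (1 : ℝ) ≤ k (n + 2) := by exact_mod_cast hk (n + 2)
  have e : (1 - c (n + 2) / c (n + 1)) * (c (n + 1) / c n) / (c (n + 3) / c (n + 2)) =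
      (c (n + 1) - c (n + 2)) * c (n + 2) / (c n * c (n + 3)) := by
    field_simp
  rw [e, show n + 3 - 1 = n + 2 by omega, div_le_div_iff₀ (by positivity) (by linarith)]
  -- both `k (n+3) * c (n+3)` and `(k (n+2) + 1) * c (n+2)` are read off from the recursion
  have a1 : c (n + 1) - c (n + 2) ≤ k (n + 3) * c (n + 3) := by linarith
  have a2 : c (n + 3) ≤ c (n + 1) - c (n + 2) := by nlinarith
  have a3 : c (n + 2) * ((k (n + 2) : ℝ) + 1) ≤ c n := by linarith
  calc (c (n + 1) - c (n + 2)) * c (n + 2) * ((k (n + 2) : ℝ) + 1)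
      = (c (n + 1) - c (n + 2)) * (c (n + 2) * ((k (n + 2) : ℝ) + 1)) := by ring
    _ ≤ (k (n + 3) * c (n + 3)) * c n := by
        apply mul_le_mul a1 a3 (by positivity) (by positivity)
    _ = _ := by ring

include hk h hpos hN hs in
theorem not_tendsto_prod {e : ℕ → ℕ} (he : ∀ i, 1 ≤ i → e (i + 1) = e i + 2) :
    ¬ Tendsto (fun N : ℕ => ∏ i ∈ Finset.Icc 1 N, prodTerm k (e i)) atTop (𝓝 0) := by
  set r : ℕ → ℝ := fun n => c (n + 1) / c n with hr
  have hr0 : ∀ n, 0 < r n := fun n => div_pos (hpos _) (hpos _)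
  have hr1 : ∀ n, r n ≤ 1 := fun n => (div_le_one (hpos n)).2 (h.succ_le n)
  have hP0 : ∀ n, 0 < prodTerm k n := fun n => by
    refine lt_of_lt_of_le ?_ (le_prodTerm hk n)
    have : (1 : ℝ) ≤ k n := by exact_mod_cast hk n
    positivity
  have hinj : ∀ i, e (i + 1) = e 1 + 2 * i := by
    intro i
    induction i with
    | zero => rfl
    | succ i ih => rw [he _ (by omega), ih]; ring
  -- a tail of `r` with sum less than `1/2`
  obtain ⟨M, hM⟩ : ∃ M, ∀ n, ∑ i ∈ Finset.range n, r (M + i) ≤ 1 / 2 := by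
    have h1 := (tendsto_sum_nat_add r).eventually
      (gt_mem_nhds (show (0 : ℝ) < 1 / 2 by norm_num))
    obtain ⟨M, hM⟩ := h1.exists
    refine ⟨M, fun n => le_trans ?_ hM.le⟩
    have h2 : Summable fun i => r (i + M) := (summable_nat_add_iff M).2 hs
    simpa only [add_comm M] using h2.sum_le_tsum (Finset.range n) fun i _ => (hr0 _).le
  -- the index `i₀` from which the estimates hold
  obtain ⟨i₀, hi₀⟩ : ∃ i₀, i₀ = M + N + 3 := ⟨_, rfl⟩
  obtain ⟨q, hq⟩ : ∃ q, e (i₀ + 1) = q + 3 := ⟨e (i₀ + 1) - 3, by have := hinj i₀; omega⟩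
  have hq' : ∀ j, e (i₀ + j + 1) = q + 2 * j + 3 := fun j => by
    have := hinj i₀
    have := hinj (i₀ + j)
    omega
  have hqM : M ≤ q ∧ N ≤ q := by have := hinj i₀; omega
  have hPi : 0 < ∏ i ∈ Finset.Icc 1 i₀, prodTerm k (e i) := Finset.prod_pos fun i _ => hP0 _
  have key : ∀ j, (∏ i ∈ Finset.Icc 1 i₀, prodTerm k (e i)) *
      ((1 - ∑ i ∈ Finset.range (2 * j), r (q + i)) * (r q / r (q + 2 * j))) ≤
      ∏ i ∈ Finset.Icc 1 (i₀ + j), prodTerm k (e i) := by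
    intro j
    induction j with
    | zero => simp [div_self (hr0 q).ne']
    | succ j ih =>
      rw [show i₀ + (j + 1) = i₀ + j + 1 by ring, Finset.prod_Icc_succ_top (by omega), hq']
      have h1 := mul_le_prodTerm hk h hpos (n := q + 2 * j) (hN _ (by omega))
      have h2 : (1 - r (q + 2 * j + 1)) * r (q + 2 * j) / r (q + 2 * j + 2) ≤
          prodTerm k (q + 2 * j + 3) := h1
      have h3 : 0 ≤ (1 - r (q + 2 * j + 1)) * r (q + 2 * j) / r (q + 2 * j + 2) :=
        div_nonneg (mul_nonneg (sub_nonneg.2 (hr1 _)) (hr0 _).le) (hr0 _).le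
      have h4 := mul_le_mul ih h2 h3 (Finset.prod_nonneg fun i _ => (hP0 _).le)
      refine le_trans ?_ h4
      have e1 : 2 * (j + 1) = 2 * j + 1 + 1 := by ring
      rw [e1, Finset.sum_range_succ, Finset.sum_range_succ,
        show q + (2 * j + 1) = q + 2 * j + 1 by ring,
        show q + (2 * j + 1 + 1) = q + 2 * j + 2 by ring, mul_assoc]
      refine mul_le_mul_of_nonneg_left ?_ hPi.le
      have p1 := hr0 (q + 2 * j)
      have p2 := hr0 (q + 2 * j + 2)
      have p3 := hr0 q
      have p4 := hr0 (q + 2 * j + 1)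
      have hS : 0 ≤ ∑ i ∈ Finset.range (2 * j), r (q + i) := Finset.sum_nonneg fun i _ => (hr0 _).le
      have e2 : (1 - ∑ i ∈ Finset.range (2 * j), r (q + i)) * (r q / r (q + 2 * j)) *
          ((1 - r (q + 2 * j + 1)) * r (q + 2 * j) / r (q + 2 * j + 2)) =
          (1 - ∑ i ∈ Finset.range (2 * j), r (q + i)) * (1 - r (q + 2 * j + 1)) *
            (r q / r (q + 2 * j + 2)) := by
        field_simp
      rw [e2]
      refine mul_le_mul_of_nonneg_right ?_ (by positivity)
      nlinarith [mul_nonneg hS p4.le]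
  have hsum : ∀ n, ∑ i ∈ Finset.range n, r (q + i) ≤ 1 / 2 := fun n => by
    refine le_trans ?_ (hM (q - M + n))
    rw [Finset.sum_range_add]
    have : ∀ i, M + (q - M + i) = q + i := fun i => by omega
    simp only [this]
    exact le_add_of_nonneg_left (Finset.sum_nonneg fun i _ => (hr0 _).le)
  have hlow : ∀ j, (∏ i ∈ Finset.Icc 1 i₀, prodTerm k (e i)) * (1 / 2 * r q) ≤
      ∏ i ∈ Finset.Icc 1 (i₀ + j), prodTerm k (e i) := fun j => by
    refine le_trans (mul_le_mul_of_nonneg_left ?_ hPi.le) (key j)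
    refine mul_le_mul (by linarith [hsum (2 * j)]) ?_ (hr0 q).le (by linarith [hsum (2 * j)])
    rw [le_div_iff₀ (hr0 _)]
    exact mul_le_of_le_one_right (hr0 q).le (hr1 _)
  intro ht
  have hpos' : 0 < (∏ i ∈ Finset.Icc 1 i₀, prodTerm k (e i)) * (1 / 2 * r q) :=
    mul_pos hPi (mul_pos (by norm_num) (hr0 q))
  have h1 := (ht.eventually (gt_mem_nhds hpos')).and (eventually_ge_atTop i₀)
  obtain ⟨n, hn1, hn2⟩ := h1.exists
  obtain ⟨j, rfl⟩ := Nat.exists_eq_add_of_le hn2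
  exact absurd (hlow j) (not_le.2 hn1)

end MassSequence

/-- Under any of the four conditions the mass sequences form a single ray. -/
theorem MassSequence.proportional {k : ℕ → ℕ} {c c' : ℕ → ℝ} (hk : ∀ n, 1 ≤ k n)
    (hf : ∀ n, ∃ m, 2 ≤ k (n + 2 * m)) (h : MassSequence k c) (h' : MassSequence k c')
    (h0 : 0 < c 0 + c' 0)
    (hcond :
      Tendsto (fun N : ℕ => ∑ i ∈ Finset.Icc 1 N, sumTerm k (2 * i)) atTop atTop ∨
      Tendsto (fun N : ℕ => ∏ i ∈ Finset.Icc 1 N, prodTerm k (2 * i)) atTop (𝓝 0) ∨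
      Tendsto (fun N : ℕ => ∑ i ∈ Finset.Icc 1 N, sumTerm k (2 * i - 1)) atTop atTop ∨
      Tendsto (fun N : ℕ => ∏ i ∈ Finset.Icc 1 N, prodTerm k (2 * i - 1)) atTop (𝓝 0)) :
    ∃ t : ℝ, ∀ n, c n = t * (c n + c' n) := by
  have hs := h.add h'
  have hp : ∀ n, 0 < c n + c' n := hs.pos h0
  rcases (h.ratioSystem h' hk hf h0).const_or_summable with ⟨t, ht⟩ | ⟨N, hN, hsum⟩
  · exact ⟨t, fun n => (div_eq_iff (hp n).ne').1 (ht n)⟩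
  · exfalso
    have he : ∀ i : ℕ, 1 ≤ i → 2 * (i + 1) = 2 * i + 2 := fun i _ => by ring
    have ho : ∀ i : ℕ, 1 ≤ i → 2 * (i + 1) - 1 = 2 * i - 1 + 2 := fun i _ => by omega
    rcases hcond with hc | hc | hc | hc
    · exact not_tendsto_sum hk hs hp hsum (e := fun i => 2 * i) he hc
    · exact not_tendsto_prod hk hs hp hN hsum (e := fun i => 2 * i) he hc
    · exact not_tendsto_sum hk hs hp hsum (e := fun i => 2 * i - 1) ho hc
    · exact not_tendsto_prod hk hs hp hN hsum (e := fun i => 2 * i - 1) ho hc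

end ITM

/-! ### Renormalization of the map -/

namespace ITM

theorem omega_eq_image_iterate (α β : ℝ) (n : ℕ) : Omega α β n = (T α β)^[n] '' Set.Ico 0 1 := by
  induction n with
  | zero => simp [Omega]
  | succ n ih => rw [Omega, ih, Function.iterate_succ', Set.image_comp]

/-- A set mapped onto itself that absorbs `[0,1)` in bounded time is the limit of the `Ω_n`. -/
theorem isFiniteType_of_image_eq {α β : ℝ} {A : Set ℝ} (hA : A ⊆ Set.Ico 0 1)
    (hT : T α β '' A = A) {N : ℕ} (hN : ∀ x ∈ Set.Ico (0 : ℝ) 1, (T α β)^[N] x ∈ A) :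
    IsFiniteType α β := by
  have hit : ∀ n, (T α β)^[n] '' A = A := by
    intro n
    induction n with
    | zero => simp
    | succ n ih => rw [Function.iterate_succ', Set.image_comp, ih, hT]
  have h1 : Omega α β N = A := by
    rw [omega_eq_image_iterate]
    refine Set.Subset.antisymm ?_ ?_
    · rintro _ ⟨x, hx, rfl⟩
      exact hN x hx
    · calc A = (T α β)^[N] '' A := (hit N).symm
        _ ⊆ _ := Set.image_mono hA
  exact ⟨N, by rw [Omega, h1, hT]⟩

/-- The affine chart of `[1-α, 1)` by `[0,1)`. -/
noncomputable def embed (α y : ℝ) : ℝ := 1 - α + α * y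

/-- The first point of the orbit of `x` in `[1-α, 1)`, read in the chart `embed α`.  The orbit moves
by `α` until it gets there. -/
noncomputable def proj (α x : ℝ) : ℝ := Int.fract ((x - 1) / α)

theorem proj_mem (α x : ℝ) : proj α x ∈ Set.Ico (0 : ℝ) 1 := ⟨Int.fract_nonneg _, Int.fract_lt_one _⟩

theorem embed_mem {α : ℝ} (h0 : 0 < α) {y : ℝ} (hy : y ∈ Set.Ico (0 : ℝ) 1) :
    embed α y ∈ Set.Ico (1 - α) 1 := by
  unfold embed
  constructor <;> nlinarith [hy.1, hy.2]

theorem embed_proj_of_mem {α : ℝ} (h0 : 0 < α) {x : ℝ} (hx : x ∈ Set.Ico (1 - α) 1) :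
    embed α (proj α x) = x := by
  have : proj α x = (x - 1) / α + 1 := by
    unfold proj
    rw [← Int.fract_add_one, Int.fract_eq_self]
    have h1 : (x - 1) / α + 1 = (x - (1 - α)) / α := by field_simp; ring
    rw [h1]
    exact ⟨div_nonneg (by linarith [hx.1]) h0.le, (div_lt_one h0).2 (by linarith [hx.2])⟩
  rw [this, embed]
  field_simp
  ring

theorem proj_T_of_lt {α β x : ℝ} (h0 : 0 < α) (hx : x < 1 - α) : proj α (T α β x) = proj α x := by
  unfold proj T
  rw [if_pos hx, show (x + α - 1) / α = (x - 1) / α + 1 by field_simp; ring, Int.fract_add_one]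

theorem gaussMap_snd {α β : ℝ} :
    (gaussMap (α, β)).2 = β / α - Int.fract (1 / α) := by
  rw [Int.fract]
  simp only [gaussMap]
  ring

section

variable {α β : ℝ} (hβ : 0 < β) (hβα : β < α) (hα : α < 1)

include hβ hβα in
theorem proj_T_embed {y : ℝ} (hy : y ∈ Set.Ico (0 : ℝ) 1) :
    proj α (T α β (embed α y)) = T (gaussMap (α, β)).1 (gaussMap (α, β)).2 y := by
  have h0 : 0 < α := hβ.trans hβα
  have hm := embed_mem h0 hy
  have h1 : (gaussMap (α, β)).1 = β / α := rfl
  have hf0 := Int.fract_nonneg (1 / α)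
  have hf1 := Int.fract_lt_one (1 / α)
  have h2 := gaussMap_snd (α := α) (β := β)
  have hab : β / α < 1 := (div_lt_one h0).2 hβα
  have hab0 : 0 < β / α := div_pos hβ h0
  have hiff : embed α y < 1 - β ↔ y < 1 - β / α := by
    unfold embed
    have : α * (1 - β / α) = α - β := by field_simp
    rw [← mul_lt_mul_iff_right₀ h0 (b := y), this]
    constructor <;> intro h <;> linarith
  by_cases hc : y < 1 - β / α
  · have e1 : T α β (embed α y) = embed α y + β := by
      unfold T
      rw [if_neg (not_lt.2 hm.1), if_pos (hiff.2 hc)]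
    have e2 : T (gaussMap (α, β)).1 (gaussMap (α, β)).2 y = y + β / α := by
      unfold T
      rw [h1, if_pos hc]
    rw [e1, e2, proj, embed, show (1 - α + α * y + β - 1) / α = y + β / α - 1 by field_simp; ring,
      Int.fract_sub_one, Int.fract_eq_self]
    constructor <;> linarith [hy.1]
  · have e1 : T α β (embed α y) = embed α y + β - 1 := by
      unfold T
      rw [if_neg (not_lt.2 hm.1), if_neg (fun h => hc (hiff.1 h))]
    have e2 : proj α (embed α y + β - 1) = Int.fract (y + (gaussMap (α, β)).2) := by
      rw [proj, embed, show (1 - α + α * y + β - 1 - 1) / α =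
        y + (gaussMap (α, β)).2 - ((1 + ⌊1 / α⌋ : ℤ) : ℝ) by
          simp only [gaussMap]; push_cast; field_simp; ring, Int.fract_sub_intCast]
    have e3 : T (gaussMap (α, β)).1 (gaussMap (α, β)).2 y =
        if y < 1 - (gaussMap (α, β)).2 then y + (gaussMap (α, β)).2
        else y + (gaussMap (α, β)).2 - 1 := by
      unfold T
      rw [h1, if_neg hc]
    rw [e1, e2, e3]
    rw [not_lt] at hc
    split_ifs with hd
    · rw [Int.fract_eq_self]
      constructor <;> linarith
    · rw [← Int.fract_sub_one, Int.fract_eq_self]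
      constructor <;> linarith [hy.2]

include hβ hβα in
theorem exists_iterate_eq_embed_proj {x : ℝ} (hx : x ∈ Set.Ico (0 : ℝ) 1) :
    ∃ t ≤ ⌈1 / α⌉₊, (T α β)^[t] x = embed α (proj α x) := by
  have h0 : 0 < α := hβ.trans hβα
  -- each step off `[1-α,1)` adds `α`
  have key : ∀ n : ℕ, (∃ t ≤ n, (T α β)^[t] x = embed α (proj α x)) ∨
      ((T α β)^[n] x = x + n * α ∧ proj α (x + n * α) = proj α x ∧ x + n * α < 1) := by
    intro n
    induction n with
    | zero => exact Or.inr (by simpa using hx.2)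
    | succ n ih =>
      rcases ih with ⟨t, ht, e⟩ | ⟨e1, e2, e3⟩
      · exact Or.inl ⟨t, by omega, e⟩
      · by_cases hc : x + n * α < 1 - α
        · right
          have e4 : T α β (x + n * α) = x + (n + 1 : ℕ) * α := by
            unfold T
            rw [if_pos hc]
            push_cast
            ring
          refine ⟨by rw [Function.iterate_succ_apply', e1, e4], ?_, ?_⟩
          · rw [← e4, proj_T_of_lt h0 hc, e2]
          · push_cast
            linarith
        · refine Or.inl ⟨n, by omega, ?_⟩
          rw [e1, ← e2, embed_proj_of_mem h0 ⟨not_lt.1 hc, e3⟩]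
  rcases key ⌈1 / α⌉₊ with h | ⟨-, -, h⟩
  · exact h
  · exfalso
    have h1 := Nat.le_ceil (1 / α)
    rw [div_le_iff₀ h0] at h1
    linarith [hx.1]

include hβ hβα in
theorem gaussMap_maps {y : ℝ} (hy : y ∈ Set.Ico (0 : ℝ) 1) :
    T (gaussMap (α, β)).1 (gaussMap (α, β)).2 y ∈ Set.Ico (0 : ℝ) 1 := by
  rw [← proj_T_embed hβ hβα hy]
  exact proj_mem _ _

include hβ hβα hα in
/-- The saturation of an attractor of the induced map is an attractor of `T`. -/
theorem isFiniteType_of_gaussMap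
    (hfin : IsFiniteType (gaussMap (α, β)).1 (gaussMap (α, β)).2) : IsFiniteType α β := by
  have h0 : 0 < α := hβ.trans hβα
  set T' := T (gaussMap (α, β)).1 (gaussMap (α, β)).2 with hT'
  have hmaps : Set.MapsTo T' (Set.Ico 0 1) (Set.Ico 0 1) := fun y hy => gaussMap_maps hβ hβα hy
  have hmT : Set.MapsTo (T α β) (Set.Ico 0 1) (Set.Ico 0 1) := mapsTo_T hβ.le hβα.le hα.le
  obtain ⟨n, hn⟩ := hfin
  set A := Omega (gaussMap (α, β)).1 (gaussMap (α, β)).2 n with hA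
  have hAT : T' '' A = A := hn.symm
  have hA1 : A ⊆ Set.Ico 0 1 := by
    rw [hA, omega_eq_image_iterate]
    rintro _ ⟨y, hy, rfl⟩
    exact hmaps.iterate n hy
  have hret : ∀ y ∈ Set.Ico (0 : ℝ) 1, ∃ t ≤ ⌈1 / α⌉₊ + 1, 1 ≤ t ∧
      (T α β)^[t] (embed α y) = embed α (T' y) := by
    intro y hy
    have hm := embed_mem h0 hy
    obtain ⟨t, ht, e⟩ := exists_iterate_eq_embed_proj hβ hβα
      (hmT ⟨by linarith [hm.1], hm.2⟩ : T α β (embed α y) ∈ _)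
    refine ⟨t + 1, by omega, by omega, ?_⟩
    rw [Function.iterate_succ_apply, e, proj_T_embed hβ hβα hy]
  set B : Set ℝ := {z | ∃ a ∈ A, ∃ i, z = (T α β)^[i] (embed α a)} with hB
  have hBT : ∀ z ∈ B, T α β z ∈ B := by
    rintro _ ⟨a, ha, i, rfl⟩
    exact ⟨a, ha, i + 1, (Function.iterate_succ_apply' _ _ _).symm⟩
  have hBTn : ∀ j, ∀ z ∈ B, (T α β)^[j] z ∈ B := fun j z hz =>
    Set.MapsTo.iterate (s := B) hBT j hz
  refine isFiniteType_of_image_eq (A := B) (N := ⌈1 / α⌉₊ + (⌈1 / α⌉₊ + 1) * n) ?_ ?_ ?_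
  · rintro _ ⟨a, ha, i, rfl⟩
    have hm := embed_mem h0 (hA1 ha)
    exact hmT.iterate i ⟨by linarith [hm.1], hm.2⟩
  · refine Set.Subset.antisymm ?_ ?_
    · rintro _ ⟨z, hz, rfl⟩
      exact hBT z hz
    · rintro _ ⟨a, ha, i, rfl⟩
      cases i with
      | succ i => exact ⟨_, ⟨a, ha, i, rfl⟩, (Function.iterate_succ_apply' _ _ _).symm⟩
      | zero =>
        obtain ⟨a1, ha1, rfl⟩ : a ∈ T' '' A := by rwa [hAT]
        obtain ⟨t, -, ht, e⟩ := hret a1 (hA1 ha1)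
        obtain ⟨s, rfl⟩ : ∃ s, t = s + 1 := ⟨t - 1, by omega⟩
        exact ⟨_, ⟨a1, ha1, s, rfl⟩, by
          rw [← Function.iterate_succ_apply' (T α β), e, Function.iterate_zero, id]⟩
  · intro x hx
    have hiter : ∀ m, ∀ y ∈ Set.Ico (0 : ℝ) 1, ∃ s ≤ (⌈1 / α⌉₊ + 1) * m,
        (T α β)^[s] (embed α y) = embed α (T'^[m] y) := by
      intro m
      induction m with
      | zero => exact fun y _ => ⟨0, by simp, rfl⟩
      | succ m ih =>
        intro y hy
        obtain ⟨t, ht, -, e⟩ := hret y hy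
        obtain ⟨s, hs, e'⟩ := ih (T' y) (hmaps hy)
        exact ⟨s + t, by rw [mul_add, mul_one]; omega, by
          rw [Function.iterate_add_apply, e, e', Function.iterate_succ_apply]⟩
    obtain ⟨t, ht, e⟩ := exists_iterate_eq_embed_proj hβ hβα hx
    obtain ⟨s, hs, e'⟩ := hiter n (proj α x) (proj_mem _ _)
    have hmem : (T α β)^[s + t] x ∈ B := by
      rw [Function.iterate_add_apply, e, e']
      refine ⟨_, ?_, 0, rfl⟩
      rw [hA, omega_eq_image_iterate]
      exact ⟨_, proj_mem _ _, rfl⟩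
    have := hBTn (⌈1 / α⌉₊ + (⌈1 / α⌉₊ + 1) * n - (s + t)) _ hmem
    rwa [← Function.iterate_add_apply, Nat.sub_add_cancel (by omega)] at this

end

theorem isFiniteType_of_nonpos {a b : ℝ} (ha : 0 < a) (hb : b ≤ 0) (hab : a - 1 ≤ b) :
    IsFiniteType a b := by
  -- on `[1-a+b,1)` the map is a rotation
  set A := Set.Ico (1 - a + b) 1 with hA
  have hmaps : ∀ z ∈ A, T a b z ∈ A := by
    rintro z ⟨h1, h2⟩
    unfold T
    split_ifs <;> constructor <;> linarith
  refine isFiniteType_of_image_eq (A := A) (N := ⌈1 / a⌉₊) ?_ ?_ ?_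
  · rintro z ⟨h1, h2⟩
    exact ⟨by linarith, h2⟩
  · refine Set.Subset.antisymm ?_ ?_
    · rintro _ ⟨z, hz, rfl⟩
      exact hmaps z hz
    · rintro w ⟨h1, h2⟩
      by_cases hw : w < 1 + b
      · refine ⟨w - b, ⟨by linarith, by linarith⟩, ?_⟩
        unfold T
        rw [if_neg (by linarith), if_pos (by linarith)]
        ring
      · refine ⟨w - a, ⟨by linarith, by linarith⟩, ?_⟩
        unfold T
        rw [if_pos (by linarith)]
        ring
  · intro x hx
    have key : ∀ n : ℕ, (T a b)^[n] x ∈ A ∨ (n * a ≤ (T a b)^[n] x ∧ (T a b)^[n] x < 1) := by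
      intro n
      induction n with
      | zero => exact Or.inr (by simpa using hx)
      | succ n ih =>
        rw [Function.iterate_succ_apply']
        rcases ih with h | ⟨h1, h2⟩
        · exact Or.inl (hmaps _ h)
        · by_cases hc : (T a b)^[n] x ∈ A
          · exact Or.inl (hmaps _ hc)
          · right
            have h3 : (T a b)^[n] x < 1 - a + b := by
              by_contra h4
              exact hc ⟨not_lt.1 h4, h2⟩
            generalize (T a b)^[n] x = z at *
            unfold T
            rw [if_pos (by linarith)]
            push_cast
            constructor <;> linarith
    rcases key ⌈1 / a⌉₊ with h | ⟨h1, h2⟩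
    · exact h
    · exfalso
      have h3 := Nat.le_ceil (1 / a)
      rw [div_le_iff₀ ha] at h3
      linarith

theorem isFiniteType_self {a : ℝ} (ha : 0 < a) (ha1 : a < 1) : IsFiniteType a a := by
  refine isFiniteType_of_image_eq (A := Set.Ico 0 1) (N := 0) subset_rfl ?_ fun x hx => hx
  refine Set.Subset.antisymm ?_ ?_
  · rintro _ ⟨z, hz, rfl⟩
    exact mapsTo_T ha.le le_rfl ha1.le hz
  · rintro w ⟨h1, h2⟩
    unfold T
    by_cases hw : w < a
    · refine ⟨w - a + 1, ⟨by linarith, by linarith⟩, ?_⟩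
      simp only
      rw [if_neg (by linarith), if_neg (by linarith)]
      ring
    · refine ⟨w - a, ⟨by linarith, by linarith⟩, ?_⟩
      simp only
      rw [if_pos (by linarith)]
      ring

/-- The parameters for which the renormalization can be carried on for ever. -/
structure Admissible (p : ℝ × ℝ) : Prop where
  snd_pos : 0 < p.2
  snd_lt : p.2 < p.1
  fst_lt : p.1 < 1
  infinite : IsInfiniteType p.1 p.2

namespace Admissible

variable {p : ℝ × ℝ}

theorem fst_pos (h : Admissible p) : 0 < p.1 := h.snd_pos.trans h.snd_lt

theorem gaussMap (h : Admissible p) : Admissible (gaussMap p) := by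
  have h0 := h.fst_pos
  have hinf : IsInfiniteType (ITM.gaussMap p).1 (ITM.gaussMap p).2 := fun hf =>
    h.infinite (isFiniteType_of_gaussMap h.snd_pos h.snd_lt h.fst_lt hf)
  have ha : 0 < (ITM.gaussMap p).1 := div_pos h.snd_pos h0
  have ha1 : (ITM.gaussMap p).1 < 1 := (div_lt_one h0).2 h.snd_lt
  have e : (ITM.gaussMap p).2 = (ITM.gaussMap p).1 - Int.fract (1 / p.1) := gaussMap_snd
  have hf0 := Int.fract_nonneg (1 / p.1)
  have hf1 := Int.fract_lt_one (1 / p.1)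
  refine ⟨?_, ?_, ha1, hinf⟩
  · by_contra hc
    exact hinf (isFiniteType_of_nonpos ha (not_lt.1 hc) (by linarith))
  · refine lt_of_le_of_ne (by linarith) fun hc => ?_
    rw [hc] at hinf
    exact hinf (isFiniteType_self ha ha1)

theorem iterate (h : Admissible p) (n : ℕ) : Admissible (ITM.gaussMap^[n] p) := by
  induction n with
  | zero => exact h
  | succ n ih => rw [Function.iterate_succ_apply']; exact ih.gaussMap

theorem one_lt (h : Admissible p) : 1 < 1 / p.1 := (one_lt_div h.fst_pos).2 h.fst_lt

theorem one_le_floor (h : Admissible p) : 1 ≤ ⌊1 / p.1⌋₊ := Nat.le_floor (by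
  rw [Nat.cast_one]; exact h.one_lt.le)

theorem fract_eq (h : Admissible p) : Int.fract (1 / p.1) = 1 / p.1 - (⌊1 / p.1⌋₊ : ℝ) := by
  rw [Int.fract, natCast_floor_eq_intCast_floor (by linarith [h.one_lt])]

theorem gaussMap_fst_mul (h : Admissible p) :
    (ITM.gaussMap p).1 * (1 - (ITM.gaussMap (ITM.gaussMap p)).1) =
      1 / p.1 - (⌊1 / p.1⌋₊ : ℝ) := by
  have e : (ITM.gaussMap p).2 = (ITM.gaussMap p).1 - Int.fract (1 / p.1) := gaussMap_snd
  have e2 : (ITM.gaussMap (ITM.gaussMap p)).1 = (ITM.gaussMap p).2 / (ITM.gaussMap p).1 := rfl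
  rw [← h.fract_eq, e2, mul_sub, mul_div_cancel₀ _ h.gaussMap.fst_pos.ne', e]
  ring

/-- In each parity class infinitely many digits are at least two: while the digits are `1`, the
distance of every second `α_n` to `1` grows. -/
theorem exists_two_le_floor (h : Admissible p) :
    ∃ m, 2 ≤ ⌊1 / (ITM.gaussMap^[2 * m] p).1⌋₊ := by
  by_contra! hc
  have h1 : ∀ m, ⌊1 / (ITM.gaussMap^[2 * m] p).1⌋₊ = 1 := fun m => by
    have := (h.iterate (2 * m)).one_le_floor
    have := hc m
    omega
  set ε : ℕ → ℝ := fun m => 1 - (ITM.gaussMap^[2 * m] p).1 with hε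
  have hε0 : ∀ m, 0 < ε m := fun m => sub_pos.2 (h.iterate _).fst_lt
  have hstep : ∀ m, ε m + ε m ^ 2 ≤ ε (m + 1) := by
    intro m
    have hq := h.iterate (2 * m)
    have e := hq.gaussMap_fst_mul
    rw [h1 m, ← Function.iterate_succ_apply' ITM.gaussMap (2 * m),
      ← Function.iterate_succ_apply' ITM.gaussMap (2 * m + 1)] at e
    have h2 := (h.iterate (2 * m + 1)).fst_lt
    have h3 := (h.iterate (2 * m + 1)).fst_pos
    have h4 := hε0 (m + 1)
    have hx0 := hq.fst_pos
    have hx1 := hq.fst_lt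
    simp only [hε] at h4 ⊢
    rw [show 2 * (m + 1) = 2 * m + 1 + 1 by ring] at h4 ⊢
    simp only [Nat.succ_eq_add_one] at e
    set x := (ITM.gaussMap^[2 * m] p).1
    have h5 : 1 / x - 1 ≤ 1 - (ITM.gaussMap^[2 * m + 1 + 1] p).1 := by
      push_cast at e
      rw [← e]
      exact mul_le_of_le_one_left h4.le h2.le
    refine le_trans ?_ h5
    rw [le_sub_iff_add_le, le_div_iff₀ hx0]
    nlinarith [mul_nonneg hx0.le (sq_nonneg (1 - x)), sq_nonneg (1 - x)]
  have hgrow : ∀ m : ℕ, ε 0 + m * ε 0 ^ 2 ≤ ε m := by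
    intro m
    induction m with
    | zero => simp
    | succ m ih =>
      have h2 : ε 0 ≤ ε m := le_trans (le_add_of_nonneg_right (by positivity)) ih
      have h3 : ε 0 ^ 2 ≤ ε m ^ 2 := pow_le_pow_left₀ (hε0 0).le h2 2
      push_cast
      linarith [hstep m]
  obtain ⟨m, hm⟩ := exists_nat_gt (1 / ε 0 ^ 2)
  rw [div_lt_iff₀ (pow_pos (hε0 0) 2)] at hm
  have h2 := (h.iterate (2 * m)).fst_pos
  have h3 := hgrow m
  have h4 := hε0 0
  simp only [hε] at h3 hm h4
  linarith

theorem exists_prod_le (h : Admissible p) {δ : ℝ} (hδ : 0 < δ) :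
    ∃ n, ∏ i ∈ Finset.range n, (ITM.gaussMap^[i] p).1 ≤ δ := by
  have hP0 : ∀ n, 0 ≤ ∏ i ∈ Finset.range n, (ITM.gaussMap^[i] p).1 := fun n =>
    Finset.prod_nonneg fun i _ => (h.iterate i).fst_pos.le
  have hanti : Antitone fun n => ∏ i ∈ Finset.range n, (ITM.gaussMap^[i] p).1 :=
    antitone_nat_of_succ_le fun n => by
      rw [Finset.prod_range_succ]
      exact mul_le_of_le_one_right (hP0 n) (h.iterate n).fst_lt.le
  have key : ∀ j : ℕ, ∃ n, ∏ i ∈ Finset.range n, (ITM.gaussMap^[i] p).1 ≤ (1 / 2) ^ j := by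
    intro j
    induction j with
    | zero => exact ⟨0, by simp⟩
    | succ j ih =>
      obtain ⟨n, hn⟩ := ih
      obtain ⟨m, hm⟩ := (h.iterate n).exists_two_le_floor
      rw [← Function.iterate_add_apply, Nat.le_floor_iff (by
        have := (h.iterate (2 * m + n)).one_lt; linarith), le_div_iff₀ (h.iterate _).fst_pos] at hm
      refine ⟨2 * m + n + 1, ?_⟩
      rw [Finset.prod_range_succ, pow_succ]
      push_cast at hm
      exact mul_le_mul ((hanti (by omega : n ≤ 2 * m + n)).trans hn) (by linarith)
        (h.iterate _).fst_pos.le (by positivity)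
  obtain ⟨j, hj⟩ := exists_pow_lt_of_lt_one hδ (show (1 / 2 : ℝ) < 1 by norm_num)
  obtain ⟨n, hn⟩ := key j
  exact ⟨n, hn.trans hj.le⟩

end Admissible
end ITM

/-! ### Induced measures and Kac's formula -/

namespace ITM

theorem measurable_T (α β : ℝ) : Measurable (T α β) := by
  unfold T
  refine Measurable.ite measurableSet_Iio (by fun_prop) ?_
  exact Measurable.ite measurableSet_Iio (by fun_prop) (by fun_prop)

theorem measurable_proj (α : ℝ) : Measurable (proj α) := by
  unfold proj
  exact measurable_fract.comp (by fun_prop)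

theorem measurable_embed (α : ℝ) : Measurable (embed α) := by
  unfold embed
  fun_prop

/-- A finite measure carried by `[0,1)` and invariant under the map with parameters `p`. -/
structure IsInvariant (p : ℝ × ℝ) (μ : Measure ℝ) : Prop where
  finite : IsFiniteMeasure μ
  compl : μ (Set.Ico (0 : ℝ) 1)ᶜ = 0
  map_eq : μ.map (T p.1 p.2) = μ

/-- The restriction of `μ` to `[1-α,1)`, without normalization, read in the chart `embed α`, whose
inverse on `[1-α,1)` is `proj α`. -/
noncomputable def induce (α : ℝ) (μ : Measure ℝ) : Measure ℝ :=
  (μ.restrict (Set.Ico (1 - α) 1)).map (proj α)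

/-- The mass of the first branch `[0,1-α)`. -/
noncomputable def mass₁ (p : ℝ × ℝ) (μ : Measure ℝ) : ℝ := μ.real (Set.Ico 0 (1 - p.1))
/-- The mass of the second branch `[1-α,1-β)`. -/
noncomputable def mass₂ (p : ℝ × ℝ) (μ : Measure ℝ) : ℝ := μ.real (Set.Ico (1 - p.1) (1 - p.2))
/-- The mass of the third branch `[1-β,1)`. -/
noncomputable def mass₃ (p : ℝ × ℝ) (μ : Measure ℝ) : ℝ := μ.real (Set.Ico (1 - p.2) 1)

/-- Bounded measurable functions, a class preserved by `transfer`. -/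
structure BddMeasurable (f : ℝ → ℝ) : Prop where
  measurable : Measurable f
  bdd : ∃ C, ∀ x, |f x| ≤ C

theorem BddMeasurable.integrable {f : ℝ → ℝ} (hf : BddMeasurable f) (μ : Measure ℝ)
    [IsFiniteMeasure μ] : Integrable f μ := by
  obtain ⟨C, hC⟩ := hf.bdd
  exact Integrable.of_bound hf.measurable.aestronglyMeasurable C (ae_of_all _ hC)

theorem BddMeasurable.comp {f : ℝ → ℝ} (hf : BddMeasurable f) {φ : ℝ → ℝ} (hφ : Measurable φ) :
    BddMeasurable fun x => f (φ x) :=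
  ⟨hf.measurable.comp hφ, hf.bdd.imp fun _ hC _ => hC _⟩

theorem BddMeasurable.add {f g : ℝ → ℝ} (hf : BddMeasurable f) (hg : BddMeasurable g) :
    BddMeasurable fun x => f x + g x := by
  obtain ⟨C, hC⟩ := hf.bdd
  obtain ⟨D, hD⟩ := hg.bdd
  exact ⟨hf.measurable.add hg.measurable, C + D, fun x =>
    (abs_add_le _ _).trans (add_le_add (hC x) (hD x))⟩

/-- The sum of `f` along the orbit of `x` before it reaches `[1-α,1)`. -/
noncomputable def hitSum (α : ℝ) (f : ℝ → ℝ) (x : ℝ) : ℝ :=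
  ∑ i ∈ Finset.range ⌊1 / α⌋₊, (Set.Iio (1 - α)).indicator f (x + i * α)

theorem BddMeasurable.hitSum {f : ℝ → ℝ} (hf : BddMeasurable f) (α : ℝ) :
    BddMeasurable (hitSum α f) := by
  obtain ⟨C, hC⟩ := hf.bdd
  refine ⟨?_, ⌊1 / α⌋₊ * C, fun x => ?_⟩
  · unfold ITM.hitSum
    refine Finset.measurable_sum _ fun i _ => ?_
    exact (hf.measurable.indicator measurableSet_Iio).comp (by fun_prop)
  · unfold ITM.hitSum
    refine (Finset.abs_sum_le_sum_abs _ _).trans ?_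
    refine (Finset.sum_le_card_nsmul _ _ C fun i _ => ?_).trans (by simp)
    rw [← Real.norm_eq_abs]
    exact (norm_indicator_le_norm_self f _).trans (hC _)

theorem hitSum_of_le {α : ℝ} (h0 : 0 < α) (f : ℝ → ℝ) {x : ℝ} (hx : 1 - α ≤ x) :
    hitSum α f x = 0 := by
  refine Finset.sum_eq_zero fun i _ => Set.indicator_of_notMem ?_ _
  have : 0 ≤ (i : ℝ) * α := by positivity
  simp only [Set.mem_Iio, not_lt]
  linarith

theorem hitSum_of_lt {α : ℝ} (h0 : 0 < α) (f : ℝ → ℝ) {x : ℝ} (hx0 : 0 ≤ x)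
    (hx : x < 1 - α) : hitSum α f x = f x + hitSum α f (x + α) := by
  have h1 : 1 ≤ ⌊1 / α⌋₊ := Nat.le_floor (by
    rw [Nat.cast_one, one_le_div h0]; linarith)
  obtain ⟨K, hK⟩ : ∃ K, ⌊1 / α⌋₊ = K + 1 := ⟨⌊1 / α⌋₊ - 1, by omega⟩
  have h2 := Nat.lt_floor_add_one (1 / α)
  rw [div_lt_iff₀ h0, hK] at h2
  push_cast at h2
  unfold hitSum
  -- after `K + 1` steps the orbit has left `[0, 1-α)`
  rw [hK, Finset.sum_range_succ', Finset.sum_range_succ, Set.indicator_of_notMem (s := Set.Iio _)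
    (a := x + α + K * α) (by simp only [Set.mem_Iio, not_lt]; linarith)]
  have e : ∀ i : ℕ, x + ((i + 1 : ℕ) : ℝ) * α = x + α + i * α := fun i => by push_cast; ring
  simp only [e]
  rw [Nat.cast_zero, zero_mul, add_zero, Set.indicator_of_mem (by exact hx)]
  ring

/-- The sum of `f` over the excursion from `embed α y` up to the return to `[1-α,1)`. -/
noncomputable def transfer (p : ℝ × ℝ) (f : ℝ → ℝ) (y : ℝ) : ℝ :=
  f (embed p.1 y) + hitSum p.1 f (T p.1 p.2 (embed p.1 y))

theorem BddMeasurable.transfer {f : ℝ → ℝ} (hf : BddMeasurable f) (p : ℝ × ℝ) :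
    BddMeasurable (transfer p f) :=
  (hf.comp (measurable_embed _)).add
    ((hf.hitSum _).comp ((measurable_T _ _).comp (measurable_embed _)))

namespace IsInvariant

variable {p : ℝ × ℝ} {μ : Measure ℝ}

theorem restrict_eq (h : IsInvariant p μ) : μ.restrict (Set.Ico 0 1) = μ :=
  Measure.restrict_eq_self_of_ae_mem (by
    rw [ae_iff]; exact h.compl)

theorem induce (hp : Admissible p) (h : IsInvariant p μ) :
    IsInvariant (gaussMap p) (ITM.induce p.1 μ) := by
  have := h.finite
  have h0 := hp.fst_pos
  refine ⟨by unfold ITM.induce; infer_instance, ?_, ?_⟩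
  · rw [ITM.induce, Measure.map_apply (measurable_proj _) measurableSet_Ico.compl]
    convert measure_empty (μ := μ.restrict _)
    ext x
    simpa using proj_mem p.1 x
  · ext B hB
    rw [Measure.map_apply (measurable_T _ _) hB, ITM.induce,
      Measure.map_apply (measurable_proj _) (measurable_T _ _ hB),
      Measure.map_apply (measurable_proj _) hB,
      Measure.restrict_apply (measurable_proj _ (measurable_T _ _ hB)),
      Measure.restrict_apply (measurable_proj _ hB)]
    set E := proj p.1 ⁻¹' B with hE
    have hEm : MeasurableSet E := measurable_proj _ hB
    have hTE : MeasurableSet (T p.1 p.2 ⁻¹' E) := measurable_T _ _ hEm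
    have e1 : proj p.1 ⁻¹' (T (gaussMap p).1 (gaussMap p).2 ⁻¹' B) ∩ Set.Ico (1 - p.1) 1 =
        T p.1 p.2 ⁻¹' E ∩ Set.Ico (1 - p.1) 1 := by
      ext x
      simp only [Set.mem_inter_iff, Set.mem_preimage, hE, and_congr_left_iff]
      intro hx
      have e := proj_T_embed hp.snd_pos hp.snd_lt (proj_mem p.1 x)
      rw [embed_proj_of_mem h0 hx] at e
      rw [e]
    rw [e1]
    -- off `[1-α,1)` membership in `E` is invariant, so that part cancels
    have e2 : T p.1 p.2 ⁻¹' E ∩ Set.Ico 0 (1 - p.1) = E ∩ Set.Ico 0 (1 - p.1) := by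
      ext x
      simp only [Set.mem_inter_iff, Set.mem_preimage, hE, and_congr_left_iff]
      intro hx
      rw [proj_T_of_lt h0 hx.2]
    have split : ∀ F : Set ℝ, MeasurableSet F → μ F =
        μ (F ∩ Set.Ico 0 (1 - p.1)) + μ (F ∩ Set.Ico (1 - p.1) 1) := by
      intro F hF
      have hd : Disjoint (Set.Ico 0 (1 - p.1)) (Set.Ico (1 - p.1) 1) :=
        Set.disjoint_left.2 fun x h1 h2 => absurd h1.2 (not_lt.2 h2.1)
      conv_lhs => rw [← h.restrict_eq, Measure.restrict_apply' measurableSet_Ico]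
      rw [← Set.Ico_union_Ico_eq_Ico (sub_nonneg.2 hp.fst_lt.le) (sub_le_self 1 h0.le),
        Set.inter_union_distrib_left]
      exact measure_union (hd.mono Set.inter_subset_right Set.inter_subset_right)
        (hF.inter measurableSet_Ico)
    have e3 : μ (T p.1 p.2 ⁻¹' E) = μ E := by
      rw [← Measure.map_apply (measurable_T _ _) hEm, h.map_eq]
    rw [split _ hTE, split E hEm, e2] at e3
    exact (ENNReal.add_right_inj (measure_ne_top _ _)).1 e3

theorem integral_eq_add (hp : Admissible p) (h : IsInvariant p μ) {f : ℝ → ℝ}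
    (hf : BddMeasurable f) : ∫ x, f x ∂μ =
      (∫ x in Set.Ico 0 (1 - p.1), f x ∂μ) + ∫ x in Set.Ico (1 - p.1) 1, f x ∂μ := by
  have := h.finite
  conv_lhs => rw [← h.restrict_eq]
  rw [← Set.Ico_union_Ico_eq_Ico (sub_nonneg.2 hp.fst_lt.le) (sub_le_self 1 hp.fst_pos.le)]
  exact setIntegral_union (Set.disjoint_left.2 fun x h1 h2 => absurd h1.2 (not_lt.2 h2.1))
    measurableSet_Ico (hf.integrable _) (hf.integrable _)

/-- Kac's formula for the return to `[1-α,1)`. -/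
theorem integral_eq_transfer (hp : Admissible p) (h : IsInvariant p μ) {f : ℝ → ℝ}
    (hf : BddMeasurable f) : ∫ x, f x ∂μ = ∫ y, transfer p f y ∂(ITM.induce p.1 μ) := by
  have := h.finite
  have h0 := hp.fst_pos
  have hh := hf.hitSum p.1
  have hhT := hh.comp (measurable_T p.1 p.2)
  have e1 : ∫ x, hitSum p.1 f x ∂μ = ∫ x, hitSum p.1 f (T p.1 p.2 x) ∂μ := by
    conv_lhs => rw [← h.map_eq]
    exact integral_map (measurable_T _ _).aemeasurable hh.measurable.aestronglyMeasurable
  rw [h.integral_eq_add hp hh, h.integral_eq_add hp hhT] at e1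
  have e2 : ∫ x in Set.Ico (1 - p.1) 1, hitSum p.1 f x ∂μ = 0 := by
    rw [setIntegral_congr_fun (g := fun _ => (0 : ℝ)) measurableSet_Ico fun x hx =>
      hitSum_of_le h0 f hx.1]
    simp
  have e3 : ∫ x in Set.Ico 0 (1 - p.1), hitSum p.1 f x ∂μ =
      (∫ x in Set.Ico 0 (1 - p.1), f x ∂μ) +
        ∫ x in Set.Ico 0 (1 - p.1), hitSum p.1 f (T p.1 p.2 x) ∂μ := by
    rw [← integral_add (hf.integrable _) (hhT.integrable _)]
    refine setIntegral_congr_fun measurableSet_Ico fun x hx => ?_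
    have : T p.1 p.2 x = x + p.1 := by rw [T, if_pos hx.2]
    simp only [this]
    exact hitSum_of_lt h0 f hx.1 hx.2
  have e4 : ∫ y, transfer p f y ∂(ITM.induce p.1 μ) =
      (∫ x in Set.Ico (1 - p.1) 1, f x ∂μ) +
        ∫ x in Set.Ico (1 - p.1) 1, hitSum p.1 f (T p.1 p.2 x) ∂μ := by
    rw [ITM.induce, integral_map (measurable_proj _).aemeasurable
      (hf.transfer p).measurable.aestronglyMeasurable,
      ← integral_add (hf.integrable _) (hhT.integrable _)]
    refine setIntegral_congr_fun measurableSet_Ico fun x hx => ?_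
    simp only [transfer, embed_proj_of_mem h0 hx]
  rw [h.integral_eq_add hp hf, e4]
  linarith

end IsInvariant

section Branches

variable {p : ℝ × ℝ} (hp : Admissible p) (f : ℝ → ℝ) {y : ℝ}
include hp

theorem T_embed_of_lt (h1 : y < 1 - (gaussMap p).1) (h0 : 0 ≤ y) :
    1 - p.1 ≤ T p.1 p.2 (embed p.1 y) := by
  have hb := hp.snd_pos
  have := hp.snd_lt
  have h2 := hp.gaussMap.fst_pos
  have hm := embed_mem hp.fst_pos ⟨h0, by linarith⟩
  have e : p.1 * (gaussMap p).1 = p.2 := mul_div_cancel₀ _ hp.fst_pos.ne'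
  have h3 := mul_lt_mul_of_pos_left h1 hp.fst_pos
  rw [mul_sub, e] at h3
  unfold T
  rw [if_neg (not_lt.2 hm.1), if_pos (by unfold embed; linarith)]
  linarith [hm.1]

theorem T_embed_of_le (h1 : 1 - (gaussMap p).1 ≤ y) :
    T p.1 p.2 (embed p.1 y) =
      1 - p.1 + p.1 * (y + (gaussMap p).2 - (⌊1 / p.1⌋₊ : ℝ)) ∧
      1 - p.2 ≤ embed p.1 y := by
  have h0 := hp.fst_pos
  have h2 := hp.snd_pos
  have h3 := hp.snd_lt
  have e : p.1 * (gaussMap p).1 = p.2 := mul_div_cancel₀ _ hp.fst_pos.ne'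
  have h4 := mul_le_mul_of_nonneg_left h1 h0.le
  rw [mul_sub, e] at h4
  have h5 : 1 - p.2 ≤ embed p.1 y := by unfold embed; linarith
  refine ⟨?_, h5⟩
  have e2 : (gaussMap p).2 = (p.2 - 1) / p.1 + (⌊1 / p.1⌋₊ : ℝ) := by
    rw [natCast_floor_eq_intCast_floor (by linarith [hp.one_lt])]
    rfl
  unfold T
  rw [if_neg (by linarith), if_neg (by linarith), e2, embed]
  field_simp
  ring

theorem transfer_of_lt (h0 : 0 ≤ y) (h1 : y < 1 - (gaussMap p).1) :
    transfer p f y = f (embed p.1 y) := by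
  rw [transfer, hitSum_of_le hp.fst_pos f (T_embed_of_lt hp h1 h0), add_zero]

theorem visit_lt {i : ℕ} (h1 : 1 - (gaussMap p).1 ≤ y) (h2 : y + (gaussMap p).2 + i < ⌊1 / p.1⌋₊) :
    T p.1 p.2 (embed p.1 y) + i * p.1 ∈ Set.Ico 0 (1 - p.1) := by
  have h0 := hp.fst_pos
  obtain ⟨e, h3⟩ := T_embed_of_le hp h1
  constructor
  · have : 0 ≤ T p.1 p.2 (embed p.1 y) := by
      have := hp.snd_lt
      have := hp.fst_lt
      unfold T
      split_ifs <;> linarith [hp.snd_pos]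
    positivity
  · rw [e]
    have := mul_lt_mul_of_pos_left h2 h0
    linarith

theorem transfer_of_mid (h1 : 1 - (gaussMap p).1 ≤ y) (h2 : y < 1 - (gaussMap p).2) :
    transfer p f y = f (embed p.1 y) +
      ∑ i ∈ Finset.range ⌊1 / p.1⌋₊, f (T p.1 p.2 (embed p.1 y) + i * p.1) := by
  rw [transfer, hitSum]
  congr 1
  refine Finset.sum_congr rfl fun i hi => Set.indicator_of_mem ?_ _
  refine (visit_lt hp h1 ?_).2
  have : (i : ℝ) + 1 ≤ ⌊1 / p.1⌋₊ := by exact_mod_cast Finset.mem_range.1 hi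
  linarith

theorem transfer_of_ge (h1 : 1 - (gaussMap p).2 ≤ y) (h2 : y < 1) :
    transfer p f y = f (embed p.1 y) +
      ∑ i ∈ Finset.range (⌊1 / p.1⌋₊ - 1), f (T p.1 p.2 (embed p.1 y) + i * p.1) := by
  have h3 := hp.gaussMap.snd_lt
  have h4 : 1 - (gaussMap p).1 ≤ y := by linarith
  obtain ⟨K, hK⟩ : ∃ K, ⌊1 / p.1⌋₊ = K + 1 := ⟨⌊1 / p.1⌋₊ - 1, by have := hp.one_le_floor; omega⟩
  have hKr : (⌊1 / p.1⌋₊ : ℝ) = K + 1 := by rw [hK]; push_cast; rfl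
  rw [transfer, hitSum, hK, Finset.sum_range_succ, Nat.add_sub_cancel, Set.indicator_of_notMem]
  · congr 1
    rw [add_zero]
    refine Finset.sum_congr rfl fun i hi => Set.indicator_of_mem ?_ _
    refine (visit_lt hp h4 ?_).2
    have : (i : ℝ) + 1 ≤ K := by exact_mod_cast Finset.mem_range.1 hi
    linarith [hp.gaussMap.fst_lt]
  · simp only [Set.mem_Iio, not_lt]
    rw [(T_embed_of_le hp h4).1, hKr]
    have := mul_le_mul_of_nonneg_left h1 hp.fst_pos.le
    linarith

end Branches

namespace IsInvariant

variable {p : ℝ × ℝ} {μ : Measure ℝ}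

theorem mass₂_eq (hp : Admissible p) : mass₂ p μ = mass₁ (gaussMap p) (ITM.induce p.1 μ) := by
  have h0 := hp.fst_pos
  rw [mass₂, mass₁, ITM.induce, map_measureReal_apply (measurable_proj _) measurableSet_Ico,
    measureReal_restrict_apply (measurable_proj _ measurableSet_Ico)]
  congr 1
  ext x
  have e : p.1 * (gaussMap p).1 = p.2 := mul_div_cancel₀ _ hp.fst_pos.ne'
  have hb := hp.snd_pos
  simp only [Set.mem_Ico, Set.mem_inter_iff, Set.mem_preimage]
  constructor
  · rintro ⟨h1, h2⟩
    have hx : x ∈ Set.Ico (1 - p.1) 1 := ⟨h1, by linarith⟩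
    have h3 := embed_proj_of_mem h0 hx
    refine ⟨⟨(proj_mem _ _).1, ?_⟩, hx⟩
    unfold embed at h3
    refine lt_of_mul_lt_mul_left ?_ h0.le
    rw [mul_sub, e]
    linarith
  · rintro ⟨⟨h1, h2⟩, hx⟩
    have h3 := embed_proj_of_mem h0 hx
    unfold embed at h3
    have h4 := mul_lt_mul_of_pos_left h2 h0
    rw [mul_sub, e] at h4
    exact ⟨hx.1, by linarith⟩

theorem real_Ico_split {μ : Measure ℝ} [IsFiniteMeasure μ] {a b c : ℝ} (h1 : a ≤ b) (h2 : b ≤ c) :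
    μ.real (Set.Ico a c) = μ.real (Set.Ico a b) + μ.real (Set.Ico b c) := by
  rw [← Set.Ico_union_Ico_eq_Ico h1 h2, measureReal_union
    (Set.disjoint_left.2 fun x h1 h2 => absurd h1.2 (not_lt.2 h2.1)) measurableSet_Ico]

theorem mass_add (hp : Admissible p) (h : IsInvariant p μ) :
    mass₁ p μ + mass₂ p μ + mass₃ p μ = μ.real Set.univ := by
  have := h.finite
  have h1 := hp.snd_pos
  have h2 := hp.snd_lt
  have h3 := hp.fst_lt
  conv_rhs => rw [← h.restrict_eq, measureReal_restrict_apply MeasurableSet.univ, Set.univ_inter]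
  rw [real_Ico_split (b := 1 - p.1) (by linarith) (by linarith),
    real_Ico_split (a := 1 - p.1) (b := 1 - p.2) (by linarith) (by linarith), mass₁, mass₂, mass₃]
  ring

theorem mass₃_eq (hp : Admissible p) (h : IsInvariant p μ) :
    mass₃ p μ = mass₂ (gaussMap p) (ITM.induce p.1 μ) +
      mass₃ (gaussMap p) (ITM.induce p.1 μ) := by
  have := h.finite
  have h1 := (h.induce hp).mass_add hp.gaussMap
  have h2 : (ITM.induce p.1 μ).real Set.univ = mass₂ p μ + mass₃ p μ := by
    rw [ITM.induce, map_measureReal_apply (measurable_proj _) MeasurableSet.univ, Set.preimage_univ,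
      measureReal_restrict_apply MeasurableSet.univ, Set.univ_inter, mass₂, mass₃,
      real_Ico_split (b := 1 - p.2) (by linarith [hp.snd_lt]) (by linarith [hp.snd_pos])]
  rw [h2, mass₂_eq hp] at h1
  linarith

theorem setIntegral_const_Ico {ν : Measure ℝ} {a b c : ℝ} {f : ℝ → ℝ}
    (hf : ∀ x ∈ Set.Ico a b, f x = c) : ∫ x in Set.Ico a b, f x ∂ν = ν.real (Set.Ico a b) * c := by
  rw [setIntegral_congr_fun (g := fun _ => c) measurableSet_Ico hf, setIntegral_const, smul_eq_mul]

theorem integral_eq_add_add (hp : Admissible p) (h : IsInvariant p μ) {f : ℝ → ℝ}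
    (hf : BddMeasurable f) : ∫ x, f x ∂μ = (∫ x in Set.Ico 0 (1 - p.1), f x ∂μ) +
      (∫ x in Set.Ico (1 - p.1) (1 - p.2), f x ∂μ) + ∫ x in Set.Ico (1 - p.2) 1, f x ∂μ := by
  have := h.finite
  rw [h.integral_eq_add hp hf, add_assoc, ← Set.Ico_union_Ico_eq_Ico (b := 1 - p.2) (a := 1 - p.1)
    (by linarith [hp.snd_lt]) (by linarith [hp.snd_pos]),
    setIntegral_union (Set.disjoint_left.2 fun x h1 h2 => absurd h1.2 (not_lt.2 h2.1))
    measurableSet_Ico (hf.integrable _).integrableOn (hf.integrable _).integrableOn]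

theorem mass₁_eq (hp : Admissible p) (h : IsInvariant p μ) :
    mass₁ p μ = ⌊1 / p.1⌋₊ * mass₂ (gaussMap p) (ITM.induce p.1 μ) +
      ((⌊1 / p.1⌋₊ : ℝ) - 1) * mass₃ (gaussMap p) (ITM.induce p.1 μ) := by
  have := h.finite
  set f : ℝ → ℝ := (Set.Iio (1 - p.1)).indicator 1 with hf
  have hfm : BddMeasurable f := by
    refine ⟨measurable_one.indicator measurableSet_Iio, 1, fun x => ?_⟩
    rw [← Real.norm_eq_abs]
    exact (norm_indicator_le_norm_self _ _).trans (by simp)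
  have f1 : ∀ x, x < 1 - p.1 → f x = 1 := fun x hx => Set.indicator_of_mem (s := Set.Iio _) hx _
  have f0 : ∀ x, 1 - p.1 ≤ x → f x = 0 := fun x hx =>
    Set.indicator_of_notMem (s := Set.Iio _) (not_lt.2 hx) _
  have e1 := h.integral_eq_transfer hp hfm
  have hq := hp.gaussMap
  have he : ∀ y, 0 ≤ y → f (embed p.1 y) = 0 := fun y hy => f0 _ (by
    have := mul_nonneg hp.fst_pos.le hy
    unfold embed; linarith)
  rw [h.integral_eq_add hp hfm, (h.induce hp).integral_eq_add_add hq (hfm.transfer p),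
    setIntegral_const_Ico (c := 1) (fun x hx => f1 x hx.2),
    setIntegral_const_Ico (c := 0) (fun x hx => f0 x hx.1),
    setIntegral_const_Ico (c := 0) (fun y hy => by
      rw [transfer_of_lt hp f hy.1 hy.2, he _ hy.1]),
    setIntegral_const_Ico (c := ⌊1 / p.1⌋₊) (fun y hy => by
      have hy0 : 0 ≤ y := by linarith [hy.1, hq.fst_lt]
      rw [transfer_of_mid hp f hy.1 hy.2, he _ hy0, Finset.sum_congr rfl fun i hi => f1 _ ?_]
      · simp
      · refine (visit_lt hp hy.1 ?_).2
        have : (i : ℝ) + 1 ≤ ⌊1 / p.1⌋₊ := by exact_mod_cast Finset.mem_range.1 hi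
        linarith [hy.2]),
    setIntegral_const_Ico (c := (⌊1 / p.1⌋₊ : ℝ) - 1) (fun y hy => by
      have hy0 : 0 ≤ y := by linarith [hy.1, hq.fst_lt, hq.snd_lt]
      rw [transfer_of_ge hp f hy.1 hy.2, he _ hy0, Finset.sum_congr rfl fun i hi => f1 _ ?_]
      · rw [Finset.sum_const, Finset.card_range, nsmul_eq_mul, Nat.cast_sub hp.one_le_floor]
        simp
      · refine (visit_lt hp (by linarith [hy.1, hq.snd_lt]) ?_).2
        have : ((i + 2 : ℕ) : ℝ) ≤ ⌊1 / p.1⌋₊ := by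
          have := Finset.mem_range.1 hi
          exact_mod_cast (by omega : i + 2 ≤ ⌊1 / p.1⌋₊)
        push_cast at this
        linarith [hy.2, hq.snd_lt, hq.fst_lt])] at e1
  rw [mass₁, mass₂, mass₃]
  linarith

end IsInvariant
end ITM

/-! ### Uniqueness -/

namespace ITM

/-- On the three branches `f` varies by at most `w₁`, `w₂`, `w₃` over distances up to `δ`. -/
structure OscBound (p : ℝ × ℝ) (f : ℝ → ℝ) (δ w₁ w₂ w₃ : ℝ) : Prop where
  first : ∀ x ∈ Set.Ico 0 (1 - p.1), ∀ y ∈ Set.Ico 0 (1 - p.1), |x - y| ≤ δ → |f x - f y| ≤ w₁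
  second : ∀ x ∈ Set.Ico (1 - p.1) (1 - p.2), ∀ y ∈ Set.Ico (1 - p.1) (1 - p.2),
    |x - y| ≤ δ → |f x - f y| ≤ w₂
  third : ∀ x ∈ Set.Ico (1 - p.2) 1, ∀ y ∈ Set.Ico (1 - p.2) 1, |x - y| ≤ δ → |f x - f y| ≤ w₃

theorem abs_embed_sub {α x y δ : ℝ} (h0 : 0 < α) (h : |x - y| ≤ δ / α) :
    |embed α x - embed α y| ≤ δ := by
  rw [embed, embed, add_sub_add_left_eq_sub, ← mul_sub, abs_mul, abs_of_pos h0]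
  rwa [le_div_iff₀ h0, mul_comm] at h

theorem abs_add_sum_sub_le {a b w v : ℝ} {u u' : ℕ → ℝ} {n : ℕ} (h : |a - b| ≤ w)
    (hu : ∀ i < n, |u i - u' i| ≤ v) :
    |a + ∑ i ∈ Finset.range n, u i - (b + ∑ i ∈ Finset.range n, u' i)| ≤ w + n * v := by
  rw [add_sub_add_comm, ← Finset.sum_sub_distrib]
  refine (abs_add_le _ _).trans (add_le_add h ?_)
  refine (Finset.abs_sum_le_sum_abs _ _).trans ?_
  refine (Finset.sum_le_card_nsmul _ _ v fun i hi => hu i (Finset.mem_range.1 hi)).trans (by simp)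

/-- The chart `embed` contracts by `α`, and `T` acts by translations along an excursion.  So the scale
grows by `1 / α`, and the bounds add up like the heights of the towers. -/
theorem OscBound.transfer {p : ℝ × ℝ} (hp : Admissible p) {f : ℝ → ℝ} {δ w₁ w₂ w₃ : ℝ}
    (h : OscBound p f δ w₁ w₂ w₃) :
    OscBound (gaussMap p) (transfer p f) (δ / p.1) w₂ (w₃ + ⌊1 / p.1⌋₊ * w₁)
      (w₃ + ((⌊1 / p.1⌋₊ : ℝ) - 1) * w₁) := by
  have h0 := hp.fst_pos
  have hq := hp.gaussMap
  -- on the last two branches of the induced map, `T` acts on `embed` as a translation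
  have hT : ∀ {x y : ℝ} (i : ℕ), 1 - (gaussMap p).1 ≤ x → 1 - (gaussMap p).1 ≤ y →
      |x - y| ≤ δ / p.1 →
      |T p.1 p.2 (embed p.1 x) + i * p.1 - (T p.1 p.2 (embed p.1 y) + i * p.1)| ≤ δ := by
    intro x y i hx hy hxy
    have e : T p.1 p.2 (embed p.1 x) + i * p.1 - (T p.1 p.2 (embed p.1 y) + i * p.1) =
        embed p.1 x - embed p.1 y := by
      rw [(T_embed_of_le hp hx).1, (T_embed_of_le hp hy).1, embed, embed]
      ring
    rw [e]
    exact abs_embed_sub h0 hxy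
  refine ⟨fun x hx y hy hxy => ?_, fun x hx y hy hxy => ?_, fun x hx y hy hxy => ?_⟩
  · rw [transfer_of_lt hp f hx.1 hx.2, transfer_of_lt hp f hy.1 hy.2]
    have key : ∀ z ∈ Set.Ico 0 (1 - (gaussMap p).1), embed p.1 z ∈ Set.Ico (1 - p.1) (1 - p.2) := by
      intro z hz
      have e : p.1 * (gaussMap p).1 = p.2 := mul_div_cancel₀ _ h0.ne'
      have h1 := mul_lt_mul_of_pos_left hz.2 h0
      rw [mul_sub, e] at h1
      refine ⟨(embed_mem h0 ⟨hz.1, by linarith [hz.2, hq.fst_pos]⟩).1, ?_⟩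
      unfold embed
      linarith
    exact h.second _ (key x hx) _ (key y hy) (abs_embed_sub h0 hxy)
  · have key : ∀ z ∈ Set.Ico (1 - (gaussMap p).1) (1 - (gaussMap p).2),
        embed p.1 z ∈ Set.Ico (1 - p.2) 1 := fun z hz =>
      ⟨(T_embed_of_le hp hz.1).2, (embed_mem h0 ⟨by linarith [hz.1, hq.fst_lt],
        by linarith [hz.2, hq.snd_pos]⟩).2⟩
    rw [transfer_of_mid hp f hx.1 hx.2, transfer_of_mid hp f hy.1 hy.2]
    refine abs_add_sum_sub_le (h.third _ (key x hx) _ (key y hy) (abs_embed_sub h0 hxy))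
      fun i hi => ?_
    have hi' : (i : ℝ) + 1 ≤ ⌊1 / p.1⌋₊ := by exact_mod_cast hi
    exact h.first _ (visit_lt hp hx.1 (by linarith [hx.2])) _ (visit_lt hp hy.1 (by linarith [hy.2]))
      (hT i hx.1 hy.1 hxy)
  · have hge : ∀ z ∈ Set.Ico (1 - (gaussMap p).2) 1, 1 - (gaussMap p).1 ≤ z := fun z hz => by
      linarith [hz.1, hq.snd_lt]
    have key : ∀ z ∈ Set.Ico (1 - (gaussMap p).2) 1, embed p.1 z ∈ Set.Ico (1 - p.2) 1 :=
      fun z hz => ⟨(T_embed_of_le hp (hge z hz)).2,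
        (embed_mem h0 ⟨by linarith [hge z hz, hq.fst_lt], hz.2⟩).2⟩
    rw [transfer_of_ge hp f hx.1 hx.2, transfer_of_ge hp f hy.1 hy.2]
    have hk : ((⌊1 / p.1⌋₊ - 1 : ℕ) : ℝ) = (⌊1 / p.1⌋₊ : ℝ) - 1 := by
      rw [Nat.cast_sub hp.one_le_floor, Nat.cast_one]
    rw [← hk]
    refine abs_add_sum_sub_le (h.third _ (key x hx) _ (key y hy) (abs_embed_sub h0 hxy))
      fun i hi => ?_
    have hi' : (i : ℝ) + 1 ≤ (⌊1 / p.1⌋₊ - 1 : ℕ) := by exact_mod_cast hi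
    rw [hk] at hi'
    exact h.first _ (visit_lt hp (hge x hx) (by linarith [hx.2, hq.snd_lt, hq.fst_lt])) _
      (visit_lt hp (hge y hy) (by linarith [hy.2, hq.snd_lt, hq.fst_lt]))
      (hT i (hge x hx) (hge y hy) hxy)

/-- Two measures giving the same mass to an interval have close integrals of a function with small
oscillation there. -/
theorem abs_setIntegral_sub_le {μ ν : Measure ℝ} [IsFiniteMeasure μ] [IsFiniteMeasure ν]
    {f : ℝ → ℝ} (hf : BddMeasurable f) {a b w : ℝ}
    (hosc : ∀ x ∈ Set.Ico a b, ∀ y ∈ Set.Ico a b, |f x - f y| ≤ w)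
    (hm : μ.real (Set.Ico a b) = ν.real (Set.Ico a b)) :
    |(∫ x in Set.Ico a b, f x ∂μ) - ∫ x in Set.Ico a b, f x ∂ν| ≤
      2 * (w * μ.real (Set.Ico a b)) := by
  rcases (Set.Ico a b).eq_empty_or_nonempty with he | ⟨x₀, hx₀⟩
  · rw [he]; simp
  · have key : ∀ (η : Measure ℝ) [IsFiniteMeasure η],
        |(∫ x in Set.Ico a b, f x ∂η) - f x₀ * η.real (Set.Ico a b)| ≤
          w * η.real (Set.Ico a b) := by
      intro η _
      have e : (∫ x in Set.Ico a b, f x ∂η) - f x₀ * η.real (Set.Ico a b) =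
          ∫ x in Set.Ico a b, (f x - f x₀) ∂η := by
        rw [integral_sub (hf.integrable _) (integrable_const _), setIntegral_const, smul_eq_mul,
          mul_comm]
      rw [e, ← Real.norm_eq_abs]
      exact norm_setIntegral_le_of_norm_le_const (measure_lt_top _ _) fun x hx => hosc x hx x₀ hx₀
    have h1 := key μ
    have h2 := key ν
    rw [← hm] at h2
    rw [abs_le] at h1 h2 ⊢
    constructor <;> linarith [h1.1, h1.2, h2.1, h2.2]

namespace IsInvariant

/-- After `n` renormalizations the scale `δ` exceeds the length of the interval; the relative error is
preserved, because masses and oscillation bounds transform dually. -/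
theorem abs_integral_sub_le (n : ℕ) : ∀ {p : ℝ × ℝ}, Admissible p → ∀ {μ ν : Measure ℝ},
    IsInvariant p μ → IsInvariant p ν → mass₁ p μ = mass₁ p ν → mass₂ p μ = mass₂ p ν →
    mass₃ p μ = mass₃ p ν → ∀ {f : ℝ → ℝ} {δ w₁ w₂ w₃ : ℝ}, BddMeasurable f →
    OscBound p f δ w₁ w₂ w₃ → ∏ i ∈ Finset.range n, (gaussMap^[i] p).1 ≤ δ →
    |(∫ x, f x ∂μ) - ∫ x, f x ∂ν| ≤ 2 * (w₁ * mass₁ p μ + w₂ * mass₂ p μ + w₃ * mass₃ p μ) := by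
  induction n with
  | zero =>
    intro p hp μ ν hμ hν m1 m2 m3 f δ w₁ w₂ w₃ hf ho hδ
    have := hμ.finite
    have := hν.finite
    have hb := hp.snd_pos
    have hb1 := hp.snd_lt
    have hb2 := hp.fst_lt
    simp only [Finset.range_zero, Finset.prod_empty] at hδ
    have h1 := abs_setIntegral_sub_le (μ := μ) (ν := ν) hf (fun x hx y hy => ho.first x hx y hy
      (abs_le.2 ⟨by linarith [hx.1, hy.2], by linarith [hx.2, hy.1]⟩)) m1
    have h2 := abs_setIntegral_sub_le (μ := μ) (ν := ν) hf (fun x hx y hy => ho.second x hx y hy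
      (abs_le.2 ⟨by linarith [hx.1, hy.2], by linarith [hx.2, hy.1]⟩)) m2
    have h3 := abs_setIntegral_sub_le (μ := μ) (ν := ν) hf (fun x hx y hy => ho.third x hx y hy
      (abs_le.2 ⟨by linarith [hx.1, hy.2], by linarith [hx.2, hy.1]⟩)) m3
    rw [hμ.integral_eq_add_add hp hf, hν.integral_eq_add_add hp hf, mass₁, mass₂, mass₃]
    rw [abs_le] at h1 h2 h3 ⊢
    constructor <;> linarith [h1.1, h1.2, h2.1, h2.2, h3.1, h3.2]
  | succ n ih =>
    intro p hp μ ν hμ hν m1 m2 m3 f δ w₁ w₂ w₃ hf ho hδ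
    have a1 := hμ.mass₁_eq hp
    have a2 := mass₂_eq (μ := μ) hp
    have a3 := hμ.mass₃_eq hp
    have b1 := hν.mass₁_eq hp
    have b2 := mass₂_eq (μ := ν) hp
    have b3 := hν.mass₃_eq hp
    rw [a1, b1] at m1
    rw [a2, b2] at m2
    rw [a3, b3] at m3
    have c2 : mass₂ (gaussMap p) (ITM.induce p.1 μ) = mass₂ (gaussMap p) (ITM.induce p.1 ν) := by
      linear_combination m1 - ((⌊1 / p.1⌋₊ : ℝ) - 1) * m3
    have := ih hp.gaussMap (hμ.induce hp) (hν.induce hp) m2 c2 (by linarith) (hf.transfer p)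
      (ho.transfer hp) (by
        rw [Finset.prod_range_succ'] at hδ
        simp only [Function.iterate_succ_apply, Function.iterate_zero, id] at hδ
        rwa [le_div_iff₀ hp.fst_pos])
    rw [hμ.integral_eq_transfer hp hf, hν.integral_eq_transfer hp hf]
    refine this.trans (le_of_eq ?_)
    rw [a1, a2, a3]
    ring

/-- The masses of the three branches determine an invariant measure. -/
theorem eq_of_mass_eq {p : ℝ × ℝ} (hp : Admissible p) {μ ν : Measure ℝ}
    (hμ : IsInvariant p μ) (hν : IsInvariant p ν) (m1 : mass₁ p μ = mass₁ p ν)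
    (m2 : mass₂ p μ = mass₂ p ν) (m3 : mass₃ p μ = mass₃ p ν) : μ = ν := by
  have := hμ.finite
  have := hν.finite
  refine ext_of_forall_integral_eq_of_IsFiniteMeasure fun F => ?_
  have hF : BddMeasurable F := ⟨F.continuous.measurable, ‖F‖, fun x => F.norm_coe_le_norm x⟩
  rw [← sub_eq_zero, ← abs_eq_zero]
  refine le_antisymm (le_of_forall_pos_le_add fun ε hε => ?_) (abs_nonneg _)
  obtain ⟨η, hη, hη'⟩ : ∃ η, 0 < η ∧ 2 * (η * μ.real Set.univ) ≤ ε := by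
    have hm : 0 ≤ μ.real Set.univ := measureReal_nonneg
    refine ⟨ε / (2 * (μ.real Set.univ + 1)), by positivity, ?_⟩
    rw [div_mul_eq_mul_div, ← mul_div_assoc, div_le_iff₀ (by positivity)]
    nlinarith
  have huc := isCompact_Icc.uniformContinuousOn_of_continuous
    (F.continuous.continuousOn (s := Set.Icc (0 : ℝ) 1))
  obtain ⟨δ, hδ, hFδ⟩ := Metric.uniformContinuousOn_iff.1 huc η hη
  have hb := hp.snd_pos
  have hb1 := hp.snd_lt
  have hb2 := hp.fst_lt
  have hosc : ∀ x ∈ Set.Icc (0 : ℝ) 1, ∀ y ∈ Set.Icc (0 : ℝ) 1, |x - y| ≤ δ / 2 →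
      |F x - F y| ≤ η := fun x hx y hy hxy =>
    (hFδ x hx y hy (by rw [Real.dist_eq]; linarith)).le
  obtain ⟨n, hn⟩ := hp.exists_prod_le (half_pos hδ)
  have := abs_integral_sub_le n hp hμ hν m1 m2 m3 hF (δ := δ / 2)
    ⟨fun x hx y hy => hosc x ⟨by linarith [hx.1], by linarith [hx.2]⟩ y
        ⟨by linarith [hy.1], by linarith [hy.2]⟩,
      fun x hx y hy => hosc x ⟨by linarith [hx.1], by linarith [hx.2]⟩ y
        ⟨by linarith [hy.1], by linarith [hy.2]⟩,
      fun x hx y hy => hosc x ⟨by linarith [hx.1], by linarith [hx.2]⟩ y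
        ⟨by linarith [hy.1], by linarith [hy.2]⟩⟩ hn
  rw [← mul_add, ← mul_add, hμ.mass_add hp] at this
  linarith

end IsInvariant

/-- The measures induced by `μ` on the successive renormalization intervals. -/
noncomputable def induceIter (p : ℝ × ℝ) (μ : Measure ℝ) : ℕ → Measure ℝ
  | 0 => μ
  | n + 1 => induce (gaussMap^[n] p).1 (ITM.induceIter p μ n)

namespace IsInvariant

variable {p : ℝ × ℝ} {μ : Measure ℝ}

theorem induceIter (hp : Admissible p) (h : IsInvariant p μ) (n : ℕ) :
    IsInvariant (gaussMap^[n] p) (ITM.induceIter p μ n) := by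
  induction n with
  | zero => exact h
  | succ n ih =>
    rw [Function.iterate_succ_apply']
    exact ih.induce (hp.iterate n)

/-- The three mass relations at level `n` of the renormalization. -/
theorem mass_rel (hp : Admissible p) (h : IsInvariant p μ) (n : ℕ) :
    mass₁ (gaussMap^[n] p) (ITM.induceIter p μ n) =
      code p.1 p.2 n * mass₂ (gaussMap^[n + 1] p) (ITM.induceIter p μ (n + 1)) +
      ((code p.1 p.2 n : ℝ) - 1) * mass₃ (gaussMap^[n + 1] p) (ITM.induceIter p μ (n + 1)) ∧
    mass₂ (gaussMap^[n] p) (ITM.induceIter p μ n) =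
      mass₁ (gaussMap^[n + 1] p) (ITM.induceIter p μ (n + 1)) ∧
    mass₃ (gaussMap^[n] p) (ITM.induceIter p μ n) =
      mass₂ (gaussMap^[n + 1] p) (ITM.induceIter p μ (n + 1)) +
      mass₃ (gaussMap^[n + 1] p) (ITM.induceIter p μ (n + 1)) := by
  have hn := h.induceIter hp n
  have hpn := hp.iterate n
  rw [Function.iterate_succ_apply']
  exact ⟨hn.mass₁_eq hpn, mass₂_eq hpn, hn.mass₃_eq hpn⟩

theorem massSequence (hp : Admissible p) (h : IsInvariant p μ) :
    MassSequence (code p.1 p.2) fun n => mass₃ (gaussMap^[n] p) (ITM.induceIter p μ n) where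
  nonneg n := measureReal_nonneg
  succ_le n := by
    rw [(h.mass_rel hp n).2.2]
    exact le_add_of_nonneg_left measureReal_nonneg
  rec_eq n := by
    obtain ⟨-, -, h1⟩ := h.mass_rel hp n
    obtain ⟨-, h2, -⟩ := h.mass_rel hp (n + 1)
    obtain ⟨h3, -, h4⟩ := h.mass_rel hp (n + 2)
    linear_combination h1 + h2 + h3 - code p.1 p.2 (n + 2) * h4

theorem mass_eq_of_massSequence (hp : Admissible p) (h : IsInvariant p μ) {c : ℕ → ℝ}
    (hc : ∀ n, c n = mass₃ (gaussMap^[n] p) (ITM.induceIter p μ n)) :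
    mass₁ p μ = code p.1 p.2 0 * (c 0 - c 1) + ((code p.1 p.2 0 : ℝ) - 1) * c 1 ∧
    mass₂ p μ = code p.1 p.2 1 * (c 1 - c 2) + ((code p.1 p.2 1 : ℝ) - 1) * c 2 ∧
    mass₃ p μ = c 0 := by
  obtain ⟨h1, h2, h3⟩ := h.mass_rel hp 0
  obtain ⟨h4, -, h6⟩ := h.mass_rel hp 1
  rw [hc 0, hc 1, hc 2]
  refine ⟨?_, ?_, rfl⟩
  · calc _ = _ := h1
      _ = _ := by rw [h3]; ring
  · calc _ = _ := h2
      _ = _ := by rw [zero_add, h4, h6]; ring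

end IsInvariant

theorem code_pos {p : ℝ × ℝ} (hp : Admissible p) (n : ℕ) : 1 ≤ code p.1 p.2 n :=
  (hp.iterate n).one_le_floor

theorem exists_two_le_code {p : ℝ × ℝ} (hp : Admissible p) (n : ℕ) :
    ∃ m, 2 ≤ code p.1 p.2 (n + 2 * m) := by
  obtain ⟨m, hm⟩ := (hp.iterate n).exists_two_le_floor
  rw [← Function.iterate_add_apply, add_comm] at hm
  exact ⟨m, hm⟩

theorem IsInvariant.mass₃_pos {p : ℝ × ℝ} (hp : Admissible p) {μ : Measure ℝ}
    (h : IsInvariant p μ) (hμ : 0 < μ.real Set.univ) : 0 < mass₃ p μ := by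
  by_contra hc
  have hs := h.massSequence hp
  have c0 : mass₃ (gaussMap^[0] p) (ITM.induceIter p μ 0) = 0 := le_antisymm (not_lt.1 hc) (hs.nonneg 0)
  have c1 : mass₃ (gaussMap^[1] p) (ITM.induceIter p μ 1) = 0 :=
    le_antisymm ((hs.succ_le 0).trans c0.le) (hs.nonneg 1)
  have c2 : mass₃ (gaussMap^[2] p) (ITM.induceIter p μ 2) = 0 :=
    le_antisymm ((hs.succ_le 1).trans c1.le) (hs.nonneg 2)
  obtain ⟨e1, e2, e3⟩ := h.mass_eq_of_massSequence hp fun n => rfl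
  rw [c0, c1] at e1
  rw [c1, c2] at e2
  rw [c0] at e3
  have := h.mass_add hp
  rw [e1, e2, e3] at this
  linarith

theorem IsInvariant.unique {p : ℝ × ℝ} (hp : Admissible p) {μ ν : Measure ℝ}
    (hμ : IsInvariant p μ) (hν : IsInvariant p ν) (h1 : μ.real Set.univ = 1)
    (h2 : ν.real Set.univ = 1)
    (hcond :
      Tendsto (fun N : ℕ => ∑ i ∈ Finset.Icc 1 N, sumTerm (code p.1 p.2) (2 * i)) atTop atTop ∨
      Tendsto (fun N : ℕ => ∏ i ∈ Finset.Icc 1 N, prodTerm (code p.1 p.2) (2 * i)) atTop (𝓝 0) ∨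
      Tendsto (fun N : ℕ => ∑ i ∈ Finset.Icc 1 N, sumTerm (code p.1 p.2) (2 * i - 1))
        atTop atTop ∨
      Tendsto (fun N : ℕ => ∏ i ∈ Finset.Icc 1 N, prodTerm (code p.1 p.2) (2 * i - 1))
        atTop (𝓝 0)) : μ = ν := by
  have hsμ := hμ.massSequence hp
  have hsν := hν.massSequence hp
  have h0 : 0 < mass₃ p μ := hμ.mass₃_pos hp (by rw [h1]; norm_num)
  obtain ⟨t, ht⟩ := MassSequence.proportional (code_pos hp) (exists_two_le_code hp) hsμ hsν
    (add_pos_of_pos_of_nonneg h0 (hsν.nonneg 0)) hcond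
  obtain ⟨a1, a2, a3⟩ := hμ.mass_eq_of_massSequence hp fun n => rfl
  obtain ⟨b1, b2, b3⟩ := hν.mass_eq_of_massSequence hp fun n => rfl
  have sμ := hμ.mass_add hp
  have sν := hν.mass_add hp
  -- the masses of `μ` are `t` times the sums, and the total masses force `t = 1/2`
  have t0 := ht 0
  have t1 := ht 1
  have t2 := ht 2
  have r1 : mass₁ p μ = t * (mass₁ p μ + mass₁ p ν) := by
    rw [a1, b1]
    linear_combination (code p.1 p.2 0 : ℝ) * (t0 - t1) + ((code p.1 p.2 0 : ℝ) - 1) * t1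
  have r2 : mass₂ p μ = t * (mass₂ p μ + mass₂ p ν) := by
    rw [a2, b2]
    linear_combination (code p.1 p.2 1 : ℝ) * (t1 - t2) + ((code p.1 p.2 1 : ℝ) - 1) * t2
  have r3 : mass₃ p μ = t * (mass₃ p μ + mass₃ p ν) := t0
  have htt : t = 1 / 2 := by
    rw [h1] at sμ
    rw [h2] at sν
    linear_combination (-1 / 2 : ℝ) * (r1 + r2 + r3) + (1 / 2 - t / 2) * sμ - t / 2 * sν
  rw [htt] at r1 r2 r3
  exact hμ.eq_of_mass_eq hp hν (by linarith) (by linarith) (by linarith)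

end ITM

/-! ### Existence -/

namespace ITM

theorem mapsTo_of_admissible {p : ℝ × ℝ} (hp : Admissible p) :
    Set.MapsTo (T p.1 p.2) (Set.Ico 0 1) (Set.Ico 0 1) :=
  mapsTo_T hp.snd_pos.le hp.snd_lt.le hp.fst_lt.le

theorem iterate_mem {p : ℝ × ℝ} (hp : Admissible p) {x : ℝ} (hx : x ∈ Set.Ico (0 : ℝ) 1) (n : ℕ) :
    (T p.1 p.2)^[n] x ∈ Set.Ico (0 : ℝ) 1 :=
  (mapsTo_of_admissible hp).iterate n hx

/-- An integer-valued invariant measure would give a strictly decreasing sequence of natural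
numbers. -/
theorem IsInvariant.not_integral {p : ℝ × ℝ} (hp : Admissible p) {μ : Measure ℝ}
    (h : IsInvariant p μ) (hμ : 0 < μ.real Set.univ)
    (hint : ∀ B, MeasurableSet B → ∃ n : ℕ, μ.real B = n) : False := by
  have hall : ∀ m, ∀ B, MeasurableSet B → ∃ n : ℕ, (ITM.induceIter p μ m).real B = n := by
    intro m
    induction m with
    | zero => exact hint
    | succ m ih =>
      intro B hB
      obtain ⟨n, hn⟩ := ih (proj (gaussMap^[m] p).1 ⁻¹' B ∩ Set.Ico (1 - (gaussMap^[m] p).1) 1)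
        ((measurable_proj _ hB).inter measurableSet_Ico)
      refine ⟨n, ?_⟩
      rw [ITM.induceIter, ITM.induce, map_measureReal_apply (measurable_proj _) hB,
        measureReal_restrict_apply (measurable_proj _ hB), hn]
  choose N hN using fun m => hall m (Set.Ico (1 - (gaussMap^[m] p).2) 1) measurableSet_Ico
  have hs := h.massSequence hp
  have hanti : StrictAnti N := strictAnti_nat_of_succ_lt fun m => by
    have h1 := hs.sub_pos (code_pos hp) (exists_two_le_code hp) (h.mass₃_pos hp hμ) m
    simp only [mass₃, hN] at h1
    exact_mod_cast sub_pos.1 h1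
  exact not_strictAnti_of_wellFoundedLT N hanti

/-- There are no periodic points: apply `IsInvariant.not_integral` to the counting measure on the
orbit. -/
theorem iterate_ne {p : ℝ × ℝ} (hp : Admissible p) {x : ℝ} (hx : x ∈ Set.Ico (0 : ℝ) 1) {m : ℕ}
    (hm : 0 < m) : (T p.1 p.2)^[m] x ≠ x := by
  classical
  intro hper
  set μ : Measure ℝ := ∑ i ∈ Finset.range m, Measure.dirac ((T p.1 p.2)^[i] x) with hμ
  have happ : ∀ B, MeasurableSet B →
      μ B = ((Finset.range m).filter fun i => (T p.1 p.2)^[i] x ∈ B).card := by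
    intro B hB
    rw [hμ, Measure.finsetSum_apply]
    simp only [Measure.dirac_apply' _ hB, Set.indicator_apply, Pi.one_apply]
    rw [Finset.sum_boole]
  have hfin : IsFiniteMeasure μ := by rw [hμ]; infer_instance
  have hinv : IsInvariant p μ := by
    refine ⟨hfin, ?_, ?_⟩
    · rw [hμ, Measure.finsetSum_apply]
      refine Finset.sum_eq_zero fun i _ => ?_
      rw [Measure.dirac_apply' _ measurableSet_Ico.compl, Set.indicator_of_notMem]
      exact Set.notMem_compl_iff.2 (iterate_mem hp hx i)
    · ext B hB
      rw [Measure.map_apply (measurable_T _ _) hB, hμ, Measure.finsetSum_apply,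
        Measure.finsetSum_apply]
      simp only [Measure.dirac_apply' _ hB, Measure.dirac_apply' _ (measurable_T _ _ hB)]
      have e1 := Finset.sum_range_succ' (fun i => B.indicator (1 : ℝ → ENNReal) ((T p.1 p.2)^[i] x)) m
      rw [Finset.sum_range_succ, hper, Function.iterate_zero, id] at e1
      have e2 := (ENNReal.add_left_inj (by
        simp only [Set.indicator_apply]; split_ifs <;> simp)).1 e1
      rw [e2]
      simp only [Function.iterate_succ_apply', Set.indicator_apply, Set.mem_preimage]
      rfl
  refine hinv.not_integral hp ?_ fun B hB => ⟨_, by rw [measureReal_def, happ B hB]; simp; rfl⟩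
  rw [measureReal_def, happ _ MeasurableSet.univ]
  simpa using hm

theorem exists_pos_le_abs (s : Finset ℝ) : ∃ δ > 0, ∀ d ∈ s, d ≠ 0 → δ ≤ |d| := by
  induction s using Finset.induction_on with
  | empty => exact ⟨1, one_pos, by simp⟩
  | insert a s ha ih =>
    obtain ⟨δ, hδ, h⟩ := ih
    by_cases h0 : a = 0
    · refine ⟨δ, hδ, fun d hd hd0 => ?_⟩
      rcases Finset.mem_insert.1 hd with rfl | hd
      · exact absurd h0 hd0
      · exact h d hd hd0
    · refine ⟨min δ |a|, lt_min hδ (abs_pos.2 h0), fun d hd hd0 => ?_⟩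
      rcases Finset.mem_insert.1 hd with rfl | hd
      · exact min_le_right _ _
      · exact (min_le_left _ _).trans (h d hd hd0)

/-- Points of an orbit that are at most `N` steps apart are at a definite distance: the displacement
takes finitely many values, and there are no periodic points. -/
theorem exists_pos_le_abs_iterate_sub {p : ℝ × ℝ} (hp : Admissible p) (N : ℕ) :
    ∃ δ > 0, ∀ x ∈ Set.Ico (0 : ℝ) 1, ∀ j, 0 < j → j ≤ N → δ ≤ |(T p.1 p.2)^[j] x - x| := by
  set s : Finset ℝ := (Finset.range (N + 1) ×ˢ Finset.range (N + 1) ×ˢ Finset.range (N + 1)).image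
    fun v => (v.1 : ℝ) * p.1 + v.2.1 * p.2 - v.2.2 with hs
  obtain ⟨δ, hδ, h⟩ := exists_pos_le_abs s
  refine ⟨δ, hδ, fun x hx j hj hjN => h _ ?_ (sub_ne_zero.2 (iterate_ne hp hx hj))⟩
  have key : ∀ j : ℕ, ∃ u v w : ℕ, u ≤ j ∧ v ≤ j ∧ w ≤ j ∧
      (T p.1 p.2)^[j] x - x = (u : ℝ) * p.1 + v * p.2 - w := by
    intro j
    induction j with
    | zero => exact ⟨0, 0, 0, by simp⟩
    | succ j ih =>
      obtain ⟨u, v, w, hu, hv, hw, e⟩ := ih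
      rw [Function.iterate_succ_apply']
      generalize (T p.1 p.2)^[j] x = z at e
      unfold T
      split_ifs
      · refine ⟨u + 1, v, w, by omega, by omega, by omega, ?_⟩
        push_cast
        linear_combination e
      · refine ⟨u, v + 1, w, by omega, by omega, by omega, ?_⟩
        push_cast
        linear_combination e
      · refine ⟨u, v + 1, w + 1, by omega, by omega, by omega, ?_⟩
        push_cast
        linear_combination e
  obtain ⟨u, v, w, hu, hv, hw, e⟩ := key j
  rw [e, hs, Finset.mem_image]
  exact ⟨(u, v, w), by simp only [Finset.mem_product, Finset.mem_range]; omega, rfl⟩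

/-- The proportion of the first `M` points of the orbit of `0` that lie in `A`. -/
noncomputable def visitFreq (p : ℝ × ℝ) (A : Set ℝ) (M : ℕ) : ℝ :=
  (∑ i ∈ Finset.range M, A.indicator (fun _ => (1 : ℝ)) ((T p.1 p.2)^[i] 0)) / M

theorem indicator_one_mem (A : Set ℝ) (x : ℝ) :
    A.indicator (fun _ => (1 : ℝ)) x ∈ Set.Icc (0 : ℝ) 1 :=
  ⟨Set.indicator_nonneg (fun _ _ => zero_le_one) _,
    Set.indicator_le' (fun _ _ => le_rfl) (fun _ _ => zero_le_one) _⟩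

theorem visitFreq_mem (p : ℝ × ℝ) (A : Set ℝ) (M : ℕ) : visitFreq p A M ∈ Set.Icc (0 : ℝ) 1 := by
  unfold visitFreq
  refine ⟨div_nonneg (Finset.sum_nonneg fun i _ => (indicator_one_mem A _).1) (Nat.cast_nonneg _),
    div_le_one_of_le₀ ?_ (Nat.cast_nonneg _)⟩
  exact (Finset.sum_le_card_nsmul _ _ 1 fun i _ => (indicator_one_mem A _).2).trans (by simp)

theorem visitFreq_Ico_le {p : ℝ × ℝ} {N : ℕ} {δ a b : ℝ}
    (hp : Admissible p)
    (hδ : ∀ x ∈ Set.Ico (0 : ℝ) 1, ∀ j, 0 < j → j ≤ N → δ ≤ |(T p.1 p.2)^[j] x - x|)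
    (hab : b - a ≤ δ) {M : ℕ} (hM : 0 < M) :
    visitFreq p (Set.Ico a b) M ≤ 1 / (N + 1) + 1 / M := by
  classical
  have hMr : (0 : ℝ) < M := by exact_mod_cast hM
  set S := (Finset.range M).filter fun i => (T p.1 p.2)^[i] 0 ∈ Set.Ico a b with hS
  have hsum : ∑ i ∈ Finset.range M,
      (Set.Ico a b).indicator (fun _ => (1 : ℝ)) ((T p.1 p.2)^[i] 0) = S.card := by
    simp only [Set.indicator_apply]
    rw [Finset.sum_boole]
  -- visits to `[a,b)` are more than `N` steps apart
  have hinj : Set.InjOn (fun i => i / (N + 1)) S := by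
    have key : ∀ i ∈ S, ∀ j ∈ S, i < j → i / (N + 1) ≠ j / (N + 1) := by
      intro i hi j hj hij he
      rw [hS, Finset.mem_filter] at hi hj
      obtain ⟨n, rfl⟩ : ∃ n, j = n + i := ⟨j - i, by omega⟩
      have h1 := Nat.div_add_mod i (N + 1)
      have h2 := Nat.div_add_mod (n + i) (N + 1)
      have h3 := Nat.mod_lt (n + i) (Nat.succ_pos N)
      rw [← he] at h2
      have hn : n ≤ N := by simp only [Nat.succ_eq_add_one] at h3; omega
      have h4 := hδ _ (iterate_mem hp (Set.left_mem_Ico.2 one_pos) i) n (by omega) hn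
      rw [← Function.iterate_add_apply] at h4
      have h5 : |(T p.1 p.2)^[n + i] 0 - (T p.1 p.2)^[i] 0| < b - a :=
        abs_lt.2 ⟨by linarith [hi.2.2, hj.2.1], by linarith [hi.2.1, hj.2.2]⟩
      linarith
    intro i hi j hj he
    rcases lt_trichotomy i j with h | h | h
    · exact absurd he (key i hi j hj h)
    · exact h
    · exact absurd he.symm (key j hj i hi h)
  have hcard : S.card ≤ M / (N + 1) + 1 := by
    rw [← Finset.card_image_of_injOn hinj, ← Finset.card_range (M / (N + 1) + 1)]
    refine Finset.card_le_card fun x hx => ?_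
    obtain ⟨i, hi, rfl⟩ := Finset.mem_image.1 hx
    have : i < M := Finset.mem_range.1 (Finset.mem_filter.1 hi).1
    exact Finset.mem_range.2 (Nat.lt_succ_of_le (Nat.div_le_div_right this.le))
  have hcard' : (S.card : ℝ) ≤ M / (N + 1) + 1 := by
    have h1 : (S.card : ℝ) ≤ ((M / (N + 1) : ℕ) : ℝ) + 1 := by exact_mod_cast hcard
    have h2 : ((M / (N + 1) : ℕ) : ℝ) ≤ (M : ℝ) / ((N + 1 : ℕ) : ℝ) := Nat.cast_div_le
    push_cast at h2
    linarith
  rw [visitFreq, hsum, div_le_iff₀ hMr]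
  refine hcard'.trans (le_of_eq ?_)
  field_simp

/-- A finitely additive invariant mean, for which short intervals are small. -/
structure InvariantMean (p : ℝ × ℝ) (m : Set ℝ → ℝ) : Prop where
  nonneg : ∀ A, 0 ≤ m A
  add : ∀ A B, Disjoint A B → m (A ∪ B) = m A + m B
  unit : m (Set.Ico 0 1) = 1
  inter : ∀ A, m (A ∩ Set.Ico 0 1) = m A
  preimage : ∀ A, m (T p.1 p.2 ⁻¹' A) = m A
  small : ∀ ε > 0, ∃ δ > 0, ∀ a b, b - a ≤ δ → m (Set.Ico a b) ≤ ε

/-- Limits of visit frequencies along a free ultrafilter. -/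
theorem exists_invariantMean {p : ℝ × ℝ} (hp : Admissible p) : ∃ m, InvariantMean p m := by
  classical
  have hlim : ∀ A, ∃ l ∈ Set.Icc (0 : ℝ) 1,
      Tendsto (visitFreq p A) (hyperfilter ℕ : Filter ℕ) (𝓝 l) := fun A =>
    isCompact_Icc.ultrafilter_le_nhds ((hyperfilter ℕ).map (visitFreq p A)) (by
      rw [le_principal_iff]
      exact Filter.mem_map.2 (univ_mem' fun M => visitFreq_mem p A M))
  choose m hm hmt using hlim
  have hle : (hyperfilter ℕ : Filter ℕ) ≤ atTop := Nat.hyperfilter_le_atTop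
  have hx : ∀ i, (T p.1 p.2)^[i] 0 ∈ Set.Ico (0 : ℝ) 1 := iterate_mem hp (Set.left_mem_Ico.2 one_pos)
  refine ⟨m, fun A => (hm A).1, fun A B hAB => ?_, ?_, fun A => ?_, fun A => ?_, fun ε hε => ?_⟩
  · refine tendsto_nhds_unique (hmt _) (((hmt A).add (hmt B)).congr fun M => ?_)
    simp only [visitFreq]
    rw [← add_div, ← Finset.sum_add_distrib]
    simp only [Set.indicator_union_of_disjoint hAB]
  · refine tendsto_nhds_unique (hmt _) (tendsto_const_nhds.congr' ?_)
    filter_upwards [hle (eventually_gt_atTop 0)] with M hM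
    simp only [visitFreq, Set.indicator_of_mem (hx _)]
    have : (M : ℝ) ≠ 0 := by exact_mod_cast hM.ne'
    simp [this]
  · refine tendsto_nhds_unique (hmt _) ((hmt A).congr fun M => ?_)
    simp only [visitFreq, Set.indicator_apply, Set.mem_inter_iff, hx, and_true]
  · -- the two frequencies differ by a boundary term of size `1 / M`
    have h1 : Tendsto (fun M : ℕ => visitFreq p A M +
        (A.indicator (fun _ => (1 : ℝ)) ((T p.1 p.2)^[M] 0) -
          A.indicator (fun _ => (1 : ℝ)) 0) / M) (hyperfilter ℕ : Filter ℕ) (𝓝 (m A + 0)) := by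
      refine (hmt A).add (Tendsto.mono_left ?_ hle)
      refine squeeze_zero_norm (fun M => ?_) tendsto_one_div_atTop_nhds_zero_nat
      rw [norm_div, Real.norm_natCast]
      refine div_le_div_of_nonneg_right ?_ (Nat.cast_nonneg _)
      have h2 := indicator_one_mem A ((T p.1 p.2)^[M] 0)
      have h3 := indicator_one_mem A 0
      exact abs_le.2 ⟨by linarith [h2.1, h3.2], by linarith [h2.2, h3.1]⟩
    rw [add_zero] at h1
    refine tendsto_nhds_unique (hmt _) (h1.congr fun M => ?_)
    simp only [visitFreq]
    rw [← add_div]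
    congr 1
    have e := Finset.sum_range_succ' (fun i => A.indicator (fun _ => (1 : ℝ)) ((T p.1 p.2)^[i] 0)) M
    rw [Finset.sum_range_succ] at e
    simp only [Function.iterate_succ_apply', Function.iterate_zero, id] at e
    have e2 : ∀ i, (T p.1 p.2 ⁻¹' A).indicator (fun _ => (1 : ℝ)) ((T p.1 p.2)^[i] 0) =
        A.indicator (fun _ => (1 : ℝ)) (T p.1 p.2 ((T p.1 p.2)^[i] 0)) := fun i => by
      simp only [Set.indicator_apply, Set.mem_preimage]
    simp only [e2]
    linarith
  · obtain ⟨N, hN⟩ := exists_nat_one_div_lt hε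
    obtain ⟨δ, hδ, h⟩ := exists_pos_le_abs_iterate_sub hp N
    refine ⟨δ, hδ, fun a b hab => ?_⟩
    have h1 : Tendsto (fun M : ℕ => (1 : ℝ) / (N + 1) + 1 / M) (hyperfilter ℕ : Filter ℕ)
        (𝓝 (1 / (N + 1) + 0)) :=
      tendsto_const_nhds.add (tendsto_one_div_atTop_nhds_zero_nat.mono_left hle)
    rw [add_zero] at h1
    refine (le_of_tendsto_of_tendsto (hmt _) h1 ?_).trans hN.le
    filter_upwards [hle (eventually_gt_atTop 0)] with M hM
    exact visitFreq_Ico_le hp h hab hM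

namespace InvariantMean

variable {p : ℝ × ℝ} {m : Set ℝ → ℝ}

theorem empty (h : InvariantMean p m) : m ∅ = 0 := by
  have := h.add ∅ ∅ (by simp)
  rw [Set.union_empty] at this
  linarith

theorem Iio_sub (h : InvariantMean p m) {a b : ℝ} (hab : a ≤ b) :
    m (Set.Iio b) = m (Set.Iio a) + m (Set.Ico a b) := by
  rw [← h.add _ _ (Set.disjoint_left.2 fun x h1 h2 => absurd (Set.mem_Iio.1 h1) (not_lt.2 h2.1)),
    Set.Iio_union_Ico_eq_Iio hab]

theorem monotone (h : InvariantMean p m) : Monotone fun t => m (Set.Iio t) := fun a b hab => by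
  simp only [h.Iio_sub hab]
  exact le_add_of_nonneg_right (h.nonneg _)

theorem continuous (h : InvariantMean p m) : Continuous fun t => m (Set.Iio t) := by
  refine Metric.continuous_iff.2 fun t ε hε => ?_
  obtain ⟨δ, hδ, hsm⟩ := h.small (ε / 2) (half_pos hε)
  refine ⟨δ, hδ, fun s hs => ?_⟩
  rw [Real.dist_eq, abs_lt] at hs ⊢
  rcases le_total s t with hst | hst
  · have h1 := h.Iio_sub hst
    have h2 := hsm s t (by linarith)
    have h3 := h.nonneg (Set.Ico s t)
    constructor <;> linarith
  · have h1 := h.Iio_sub hst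
    have h2 := hsm t s (by linarith)
    have h3 := h.nonneg (Set.Ico t s)
    constructor <;> linarith

/-- The distribution function of an invariant mean; it is continuous as short intervals are small. -/
noncomputable def stieltjes (h : InvariantMean p m) : StieltjesFunction ℝ where
  toFun t := m (Set.Iio t)
  mono' := h.monotone
  right_continuous' _ := h.continuous.continuousWithinAt

theorem stieltjes_measure_Ico (h : InvariantMean p m) (a b : ℝ) :
    h.stieltjes.measure (Set.Ico a b) = ENNReal.ofReal (m (Set.Ico a b)) := by
  have hl : ∀ t, Function.leftLim h.stieltjes t = m (Set.Iio t) := fun t =>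
    leftLim_eq_of_tendsto
      (h.continuous.continuousWithinAt (x := t))
  rw [StieltjesFunction.measure_Ico, hl, hl]
  rcases le_total a b with hab | hab
  · rw [h.Iio_sub hab, add_sub_cancel_left]
  · rw [Set.Ico_eq_empty (not_lt.2 hab), h.empty, ENNReal.ofReal_zero,
      ENNReal.ofReal_eq_zero, sub_nonpos]
    exact h.monotone hab

theorem Iio_of_nonpos (h : InvariantMean p m) {t : ℝ} (ht : t ≤ 0) : m (Set.Iio t) = 0 := by
  have e : Set.Iio t ∩ Set.Ico 0 1 = ∅ := by
    ext x
    simp only [Set.mem_inter_iff, Set.mem_Iio, Set.mem_Ico, Set.mem_empty_iff_false, iff_false]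
    rintro ⟨h1, h2, -⟩
    linarith
  rw [← h.inter, e, h.empty]

theorem Iio_of_one_le (h : InvariantMean p m) {t : ℝ} (ht : 1 ≤ t) : m (Set.Iio t) = 1 := by
  have e : Set.Iio t ∩ Set.Ico 0 1 = Set.Ico 0 1 :=
    Set.inter_eq_right.2 fun x hx => hx.2.trans_le ht
  rw [← h.inter, e, h.unit]

theorem exists_measure (h : InvariantMean p m) (hp : Admissible p) :
    ∃ μ : Measure ℝ, IsProbabilityMeasure μ ∧ IsInvariant p μ := by
  set μ := h.stieltjes.measure with hμ
  have huniv : μ Set.univ = 1 := by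
    rw [hμ, StieltjesFunction.measure_univ _ (l := 0) (u := 1), sub_zero, ENNReal.ofReal_one]
    · refine tendsto_const_nhds.congr' ?_
      filter_upwards [eventually_le_atBot 0] with t ht
      exact (h.Iio_of_nonpos ht).symm
    · refine tendsto_const_nhds.congr' ?_
      filter_upwards [eventually_ge_atTop 1] with t ht
      exact (h.Iio_of_one_le ht).symm
  have hprob : IsProbabilityMeasure μ := ⟨huniv⟩
  have hIco : ∀ a b, μ (Set.Ico a b) = ENNReal.ofReal (m (Set.Ico a b)) := h.stieltjes_measure_Ico
  have hcompl : μ (Set.Ico (0 : ℝ) 1)ᶜ = 0 := by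
    rw [prob_compl_eq_zero_iff measurableSet_Ico, hIco, h.unit, ENNReal.ofReal_one]
  have hres : ∀ A, μ (A ∩ Set.Ico 0 1) = μ A := fun A =>
    measure_inter_conull hcompl
  have hunion : ∀ A B, MeasurableSet B → Disjoint A B → μ A = ENNReal.ofReal (m A) →
      μ B = ENNReal.ofReal (m B) → μ (A ∪ B) = ENNReal.ofReal (m (A ∪ B)) := by
    intro A B hB hAB h1 h2
    rw [measure_union hAB hB, h1, h2, h.add A B hAB, ENNReal.ofReal_add (h.nonneg _) (h.nonneg _)]
  refine ⟨μ, hprob, inferInstance, hcompl, ?_⟩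
  have : IsFiniteMeasure (μ.map (T p.1 p.2)) := inferInstance
  refine Measure.ext_of_Ici _ _ fun a => ?_
  rw [Measure.map_apply (measurable_T _ _) measurableSet_Ici, ← hres, ← hres (Set.Ici a)]
  have hb := hp.snd_pos
  have hb1 := hp.snd_lt
  have hb2 := hp.fst_lt
  -- both sets are finite unions of half-open intervals, on which `μ` and the mean agree
  have e1 : Set.Ici a ∩ Set.Ico 0 1 = Set.Ico (max a 0) 1 := by
    ext x
    simp only [Set.mem_inter_iff, Set.mem_Ici, Set.mem_Ico, max_le_iff]
    tauto
  have e2 : T p.1 p.2 ⁻¹' Set.Ici a ∩ Set.Ico 0 1 =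
      (Set.Ico (max 0 (a - p.1)) (1 - p.1) ∪ Set.Ico (max (1 - p.1) (a - p.2)) (1 - p.2)) ∪
        Set.Ico (max (1 - p.2) (a - p.2 + 1)) 1 := by
    ext x
    simp only [Set.mem_inter_iff, Set.mem_preimage, Set.mem_Ici, Set.mem_Ico, Set.mem_union,
      max_le_iff, T]
    split_ifs with h1 h2
    · constructor
      · rintro ⟨h3, h4, h5⟩
        exact Or.inl (Or.inl ⟨⟨h4, by linarith⟩, h1⟩)
      · rintro ((⟨⟨h3, h4⟩, h5⟩ | ⟨⟨h3, h4⟩, h5⟩) | ⟨⟨h3, h4⟩, h5⟩)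
        · exact ⟨by linarith, h3, by linarith⟩
        · linarith
        · linarith
    · constructor
      · rintro ⟨h3, h4, h5⟩
        exact Or.inl (Or.inr ⟨⟨by linarith, by linarith⟩, h2⟩)
      · rintro ((⟨⟨h3, h4⟩, h5⟩ | ⟨⟨h3, h4⟩, h5⟩) | ⟨⟨h3, h4⟩, h5⟩)
        · linarith
        · exact ⟨by linarith, by linarith, by linarith⟩
        · linarith
    · constructor
      · rintro ⟨h3, h4, h5⟩
        exact Or.inr ⟨⟨by linarith, by linarith⟩, h5⟩
      · rintro ((⟨⟨h3, h4⟩, h5⟩ | ⟨⟨h3, h4⟩, h5⟩) | ⟨⟨h3, h4⟩, h5⟩)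
        · linarith
        · linarith
        · exact ⟨by linarith, by linarith, by linarith⟩
  have h1 : μ (T p.1 p.2 ⁻¹' Set.Ici a ∩ Set.Ico 0 1) =
      ENNReal.ofReal (m (T p.1 p.2 ⁻¹' Set.Ici a ∩ Set.Ico 0 1)) := by
    rw [e2]
    refine hunion _ _ measurableSet_Ico ?_ (hunion _ _ measurableSet_Ico ?_ (hIco _ _) (hIco _ _))
      (hIco _ _)
    · refine Set.disjoint_left.2 fun x hx hx' => ?_
      have := (le_max_left _ _).trans hx'.1
      rcases hx with hx | hx
      · linarith [hx.2]
      · linarith [hx.2]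
    · refine Set.disjoint_left.2 fun x hx hx' => ?_
      have := (le_max_left _ _).trans hx'.1
      linarith [hx.2]
  have h2 : μ (Set.Ici a ∩ Set.Ico 0 1) = ENNReal.ofReal (m (Set.Ici a ∩ Set.Ico 0 1)) := by
    rw [e1, hIco]
  rw [h1, h2, h.inter, h.inter, h.preimage]

end InvariantMean

end ITM

theorem theorem2p12 (α β : ℝ) (hβ : 0 < β) (hβα : β < α) (hα : α < 1)
    (hinf : ITM.IsInfiniteType α β)
    (hcond :
      Tendsto (fun N : ℕ => ∑ i ∈ Finset.Icc 1 N, ITM.sumTerm (ITM.code α β) (2 * i))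
        atTop atTop ∨
      Tendsto (fun N : ℕ => ∏ i ∈ Finset.Icc 1 N, ITM.prodTerm (ITM.code α β) (2 * i))
        atTop (𝓝 0) ∨
      Tendsto (fun N : ℕ => ∑ i ∈ Finset.Icc 1 N, ITM.sumTerm (ITM.code α β) (2 * i - 1))
        atTop atTop ∨
      Tendsto (fun N : ℕ => ∏ i ∈ Finset.Icc 1 N, ITM.prodTerm (ITM.code α β) (2 * i - 1))
        atTop (𝓝 0)) :
    ITM.IsUniquelyErgodic α β := by
  have hp : ITM.Admissible (α, β) := ⟨hβ, hβα, hα, hinf⟩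
  obtain ⟨m, hm⟩ := ITM.exists_invariantMean hp
  obtain ⟨μ, hμ, hinv⟩ := hm.exists_measure hp
  refine ⟨μ, ⟨hμ, hinv.compl, ITM.measurable_T α β, hinv.map_eq⟩, ?_⟩
  rintro ν ⟨hν, hνc, hνm⟩
  have hν' : ITM.IsInvariant (α, β) ν := ⟨inferInstance, hνc, hνm.map_eq⟩
  exact hν'.unique hp hinv (by simp) (by simp) hcond
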